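/- Let $n\ge 1$, $0\le j\le n-1$, $T>0$, and let $\mathbb{R}^{n-1}\times\mathbb{R}_+=\{Z=(Z_1,\dots,Z_n): Z_n\ge 0\}$ be the Euclidean half-space, with standard orthonormal basis $e_1,\dots,e_n$ and dual basis $e^1,\dots,e^n$. Write $Z'=(Z_1,\dots,Z_{n-1})$, $Z^-=(Z_1,\dots,Z_j)$, $Z^+=(Z_{j+1},\dots,Z_{n-1})$, and let $$f(Z)=f(0)-\frac{|Z^-|^2}{2}+\frac{|Z^+|^2}{2}+Z_n ,\qquad f(0)\in\mathbb{R}.$$ Let $L^2$ be the real Hilbert space of square integrable differential forms (of all degrees) on the half-space. Let $d_T=e^{-Tf}\,d\,e^{Tf}=d+T\,df\wedge$ be the unbounded operator on $L^2$ with domain $\mathrm{Dom}(d_T)=\{w\in L^2: d_Tw\in L^2\}$, where $d_Tw$ is taken in the sense of distributions on $\{Z_n>0\}$, and let $d_T^*$ be its Hilbert space adjoint. Let $D_T^2$ be the Gaffney extension of the Witten Laplacian (absolute boundary condition), that is, $$\mathrm{Dom}(D_T^2)=\{w\in\mathrm{Dom}(d_T)\cap\mathrm{Dom}(d_T^*):\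 d_Tw\in\mathrm{Dom}(d_T^*),\ d_T^*w\in\mathrm{Dom}(d_T)\},\qquad D_T^2w=d_Td_T^*w+d_T^*d_Tw .$$ Then the kernel of $D_T^2$ is one-dimensional and is spanned by $$e^{-\frac{T}{2}|Z'|^2-TZ_n}\,e^1\wedge\dots\wedge e^j .$$ Moreover, every nonzero eigenvalue of $D_T^2$ is $\ge 2T$. -/

import Mathlib

namespace HalfSpaceWitten

noncomputable section

open MeasureTheory TopologicalSpace
open scoped ContDiff InnerProductSpace Distributions

/-- The Euclidean space `ℝ^n` with `n = m + 1`.  The last coordinate is the normal coordinate `Z_n`;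
the first `m = n - 1` coordinates are the coordinates `Z'`. -/
abbrev E (m : ℕ) : Type := EuclideanSpace ℝ (Fin (m + 1))

/-- The interior `{Z_n > 0}` of the half-space `ℝ^{n-1} × ℝ₊`. -/
def halfSpace (m : ℕ) : Opens (E m) :=
  ⟨{Z | 0 < Z (Fin.last m)},
    isOpen_lt continuous_const (EuclideanSpace.proj (𝕜 := ℝ) (Fin.last m)).continuous⟩

/-- Lebesgue measure on the half-space (the boundary hyperplane is a null set). -/
def μ (m : ℕ) : Measure (E m) := volume.restrict (halfSpace m : Set (E m))

instance isLocallyFiniteMeasure_μ (m : ℕ) : IsLocallyFiniteMeasure (μ m) := by unfold μ; infer_instance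

/-- The exterior algebra `Λ(V₂^*)` of the space of covectors. -/
abbrev ExtAlg (m : ℕ) : Type := ExteriorAlgebra ℝ (Module.Dual ℝ (E m))

/-- The dual basis `e^1, …, e^n` of the standard orthonormal basis. -/
def dualBasis (m : ℕ) : Module.Basis (Fin (m + 1)) ℝ (Module.Dual ℝ (E m)) :=
  (EuclideanSpace.basisFun (Fin (m + 1)) ℝ).toBasis.dualBasis

/-- The exterior algebra `Λ(V₂^*)` as a Euclidean space: an element is given by its coordinates in
the basis `e^I = e^{i_1} ∧ … ∧ e^{i_k}`, `I = {i_1 < … < i_k}`, which is orthonormal. -/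
abbrev Lam (m : ℕ) : Type := EuclideanSpace ℝ (Finset (Fin (m + 1)))

/-- The coordinates of an element of the exterior algebra in the basis `(e^I)_I`. -/
def coords (m : ℕ) : ExtAlg m ≃ₗ[ℝ] Lam m :=
  (dualBasis m).ExteriorAlgebra.equivFun ≪≫ₗ
    (WithLp.linearEquiv 2 ℝ (Finset (Fin (m + 1)) → ℝ)).symm

/-- Exterior multiplication `ξ ∧ η` of `η ∈ Λ(V₂^*)` by a covector `ξ`. -/
def wedge (m : ℕ) : (E m →L[ℝ] ℝ) →ₗ[ℝ] Lam m →ₗ[ℝ] Lam m :=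
  LinearMap.mk₂ ℝ
    (fun ξ η => coords m
      (ExteriorAlgebra.ι ℝ (ξ : Module.Dual ℝ (E m)) * (coords m).symm η))
    (fun ξ ξ' η => by simp [add_mul])
    (fun c ξ η => by simp)
    (fun ξ η η' => by simp [mul_add])
    (fun c ξ η => by simp)

/-- The Hilbert space `L²(Λ V₂^*)` of square integrable (inhomogeneous) forms on the half-space. -/
abbrev L2Forms (m : ℕ) : Type := Lp (Lam m) 2 (μ m)

/-- `IsWeakDT f T w u` says that `d_T w = u` in the sense of distributions on `{Z_n > 0}`, where
`d_T = e^{-Tf} d e^{Tf} = d + T df ∧`: for every scalar test function `φ`,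
`∫ φ u = -∫ dφ ∧ w + ∫ φ T df ∧ w`. -/
def IsWeakDT {m : ℕ} (f : E m → ℝ) (T : ℝ) (w u : L2Forms m) : Prop :=
  ∀ φ : 𝓓(halfSpace m, ℝ),
    ∫ Z, φ Z • u Z ∂(μ m) =
      ∫ Z, wedge m ((φ Z * T) • fderiv ℝ f Z - fderiv ℝ φ Z) (w Z) ∂(μ m)

theorem integrable_test_smul {m : ℕ} (φ : 𝓓(halfSpace m, ℝ)) (u : L2Forms m) :
    Integrable (fun Z => φ Z • u Z) (μ m) := by
  have hu : LocallyIntegrable u (μ m) := (Lp.memLp u).locallyIntegrable (by norm_num)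
  exact hu.integrable_smul_left_of_hasCompactSupport φ.continuous φ.hasCompactSupport

theorem integrable_wedge {m : ℕ} {f : E m → ℝ} (hf : ContDiff ℝ ∞ f) (T : ℝ)
    (φ : 𝓓(halfSpace m, ℝ)) (w : L2Forms m) :
    Integrable
      (fun Z => wedge m ((φ Z * T) • fderiv ℝ f Z - fderiv ℝ φ Z) (w Z)) (μ m) := by
  let B : (E m →L[ℝ] ℝ) →ₗ[ℝ] Lam m →L[ℝ] Lam m :=
    (LinearMap.toContinuousLinearMap : (Lam m →ₗ[ℝ] Lam m) ≃ₗ[ℝ] _).toLinearMap ∘ₗ wedge m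
  let ξ : E m → (E m →L[ℝ] ℝ) := fun Z => (φ Z * T) • fderiv ℝ f Z - fderiv ℝ φ Z
  have hφd : ContDiff ℝ ∞ φ := φ.contDiff
  have hξc : Continuous ξ := by
    have h1 : Continuous (fderiv ℝ f) := hf.continuous_fderiv (by simp)
    have h2 : Continuous (fderiv ℝ φ) := hφd.continuous_fderiv (by simp)
    have h3 : Continuous φ := φ.continuous
    fun_prop
  have hξs : HasCompactSupport ξ := by
    refine HasCompactSupport.intro' φ.hasCompactSupport.isCompact (isClosed_tsupport _) ?_
    intro Z hZ
    have h0 : φ Z = 0 := image_eq_zero_of_notMem_tsupport hZ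
    have h1 : fderiv ℝ φ Z = 0 := by
      by_contra hne
      exact hZ (support_fderiv_subset ℝ (by simpa [Function.mem_support] using hne))
    simp [ξ, h0, h1]
  have hBc : Continuous (fun Z => B (ξ Z)) := B.continuous_of_finiteDimensional.comp hξc
  have hBs : HasCompactSupport (fun Z => B (ξ Z)) := hξs.comp_left (map_zero B)
  have hB : MemLp (fun Z => B (ξ Z)) 2 (μ m) := hBc.memLp_of_hasCompactSupport hBs
  have hw := Lp.memLp w
  refine (hB.norm.integrable_mul hw.norm).mono' ?_ ?_
  · exact (isBoundedBilinearMap_apply (𝕜 := ℝ) (E := Lam m)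
      (F := Lam m)).continuous.comp_aestronglyMeasurable
      (hB.1.prodMk hw.1)
  · exact Filter.Eventually.of_forall fun Z => (B (ξ Z)).le_opNorm (w Z)

theorem IsWeakDT.unique {m : ℕ} {f : E m → ℝ} {T : ℝ} {w u u' : L2Forms m}
    (h : IsWeakDT f T w u) (h' : IsWeakDT f T w u') : u = u' := by
  have key : ∀ᵐ Z ∂(volume : Measure (E m)), Z ∈ (halfSpace m : Set (E m)) → (u Z - u' Z) = 0 := by
    refine (halfSpace m).isOpen.ae_eq_zero_of_integral_contDiff_smul_eq_zero ?_ ?_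
    · have hloc : LocallyIntegrable (fun Z => u Z - u' Z) (μ m) := by
        exact ((Lp.memLp u).sub (Lp.memLp u')).locallyIntegrable (by norm_num)
      exact locallyIntegrableOn_of_locallyIntegrable_restrict hloc
    · intro g hg hgc hgs
      let φ : 𝓓(halfSpace m, ℝ) := ⟨g, hg, hgc, hgs⟩
      have e := (h φ).trans (h' φ).symm
      have e2 : ∫ Z, g Z • (u Z - u' Z) ∂(μ m) = 0 := by
        have : (fun Z => g Z • (u Z - u' Z)) = fun Z => φ Z • u Z - φ Z • u' Z := by
          funext Z; exact smul_sub _ _ _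
        rw [this, integral_sub (integrable_test_smul φ u) (integrable_test_smul φ u'), e, sub_self]
      rw [← e2]
      refine (setIntegral_eq_integral_of_forall_compl_eq_zero ?_).symm
      intro Z hZ
      have : g Z = 0 := image_eq_zero_of_notMem_tsupport fun hh => hZ (hgs hh)
      simp [this]
  refine Lp.ext ?_
  have k2 : ∀ᵐ Z ∂(μ m), u Z - u' Z = 0 :=
    (ae_restrict_iff' (halfSpace m).isOpen.measurableSet).2 key
  filter_upwards [k2] with Z hZ using sub_eq_zero.1 hZ

theorem IsWeakDT.add {m : ℕ} {f : E m → ℝ} (hf : ContDiff ℝ ∞ f) {T : ℝ} {w w' u u' : L2Forms m}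
    (h : IsWeakDT f T w u) (h' : IsWeakDT f T w' u') : IsWeakDT f T (w + w') (u + u') := by
  intro φ
  have e1 : ∫ Z, φ Z • (u + u' : L2Forms m) Z ∂(μ m)
      = ∫ Z, (φ Z • u Z + φ Z • u' Z) ∂(μ m) := by
    refine integral_congr_ae ?_
    filter_upwards [Lp.coeFn_add u u'] with Z hZ
    rw [hZ, Pi.add_apply, smul_add]
  have e2 : ∫ Z, wedge m ((φ Z * T) • fderiv ℝ f Z - fderiv ℝ φ Z) ((w + w' : L2Forms m) Z) ∂(μ m)
      = ∫ Z, (wedge m ((φ Z * T) • fderiv ℝ f Z - fderiv ℝ φ Z) (w Z)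
          + wedge m ((φ Z * T) • fderiv ℝ f Z - fderiv ℝ φ Z) (w' Z)) ∂(μ m) := by
    refine integral_congr_ae ?_
    filter_upwards [Lp.coeFn_add w w'] with Z hZ
    rw [hZ, Pi.add_apply, map_add]
  rw [e1, e2, integral_add (integrable_test_smul φ u) (integrable_test_smul φ u'),
    integral_add (integrable_wedge hf T φ w) (integrable_wedge hf T φ w'), h φ, h' φ]

theorem IsWeakDT.smul {m : ℕ} {f : E m → ℝ} {T : ℝ} {w u : L2Forms m} (c : ℝ)
    (h : IsWeakDT f T w u) : IsWeakDT f T (c • w) (c • u) := by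
  intro φ
  have e1 : ∫ Z, φ Z • (c • u : L2Forms m) Z ∂(μ m) = ∫ Z, c • (φ Z • u Z) ∂(μ m) := by
    refine integral_congr_ae ?_
    filter_upwards [Lp.coeFn_smul c u] with Z hZ
    rw [hZ, Pi.smul_apply, smul_comm]
  have e2 : ∫ Z, wedge m ((φ Z * T) • fderiv ℝ f Z - fderiv ℝ φ Z) ((c • w : L2Forms m) Z) ∂(μ m)
      = ∫ Z, c • wedge m ((φ Z * T) • fderiv ℝ f Z - fderiv ℝ φ Z) (w Z) ∂(μ m) := by
    refine integral_congr_ae ?_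
    filter_upwards [Lp.coeFn_smul c w] with Z hZ
    rw [hZ, Pi.smul_apply, map_smul]
  rw [e1, e2, integral_smul, integral_smul, h φ]

theorem IsWeakDT.zero {m : ℕ} (f : E m → ℝ) (T : ℝ) : IsWeakDT f T (0 : L2Forms m) 0 := by
  have h0 : ∀ᵐ Z ∂(μ m), (0 : L2Forms m) Z = 0 := Lp.coeFn_zero _ _ _
  intro φ
  rw [integral_eq_zero_of_ae, integral_eq_zero_of_ae]
  · filter_upwards [h0] with Z hZ
    rw [hZ, map_zero, Pi.zero_apply]
  · filter_upwards [h0] with Z hZ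
    rw [hZ, smul_zero, Pi.zero_apply]

/-- The weak maximal extension of `d_T = d + T df ∧` as an unbounded operator on `L²(Λ V₂^*)`:
its domain is `{w ∈ L² : d_T w ∈ L²}`, with `d_T w` in the sense of distributions. -/
def dT {m : ℕ} (f : E m → ℝ) (hf : ContDiff ℝ ∞ f) (T : ℝ) : L2Forms m →ₗ.[ℝ] L2Forms m where
  domain :=
    { carrier := {w | ∃ u, IsWeakDT f T w u}
      zero_mem' := ⟨0, IsWeakDT.zero f T⟩
      add_mem' := fun ⟨_, h⟩ ⟨_, h'⟩ => ⟨_, h.add hf h'⟩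
      smul_mem' := fun c _ ⟨_, h⟩ => ⟨_, h.smul c⟩ }
  toFun :=
    { toFun := fun w => w.2.choose
      map_add' := fun w w' =>
        (w + w').2.choose_spec.unique (w.2.choose_spec.add hf w'.2.choose_spec)
      map_smul' := fun c w => (c • w).2.choose_spec.unique (w.2.choose_spec.smul c) }

/-- The composition `B A` of unbounded operators, with domain `{w ∈ Dom A : A w ∈ Dom B}`. -/
def comp {H : Type*} [AddCommGroup H] [Module ℝ H] (B A : H →ₗ.[ℝ] H) : H →ₗ.[ℝ] H :=
  B.comp (A.domRestrict ((B.domain.comap A.toFun).map A.domain.subtype)) (by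
    rintro ⟨w, ⟨⟨v, hv, rfl⟩, hw⟩⟩
    exact hv)

/-- For an unbounded operator `A` on a Hilbert space with Hilbert space adjoint `A^*`, the operator
`A A^* + A^* A` with domain `{w ∈ Dom A ∩ Dom A^* : A w ∈ Dom A^*, A^* w ∈ Dom A}`. -/
def gaffney {H : Type*} [NormedAddCommGroup H] [InnerProductSpace ℝ H] [CompleteSpace H]
    (A : H →ₗ.[ℝ] H) : H →ₗ.[ℝ] H :=
  comp A A.adjoint + comp A.adjoint A

/-- The function `f(Z) = f(0) - |Z^-|²/2 + |Z^+|²/2 + Z_n`, where `Z^- = (Z_1, …, Z_j)`,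
`Z^+ = (Z_{j+1}, …, Z_{n-1})` and `f(0) = c`. -/
def modelFn (m j : ℕ) (c : ℝ) (Z : E m) : ℝ :=
  c - (∑ i : Fin m with i.val < j, Z i.castSucc ^ 2) / 2
    + (∑ i : Fin m with j ≤ i.val, Z i.castSucc ^ 2) / 2 + Z (Fin.last m)

theorem contDiff_modelFn (m j : ℕ) (c : ℝ) : ContDiff ℝ ∞ (modelFn m j c) := by
  unfold modelFn
  fun_prop

/-- The Witten Laplacian `D_{T,v₁}²` on the half-space for the function `modelFn m j c`, with the
Gaffney domain (absolute boundary condition). -/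
def wittenLaplacian (m j : ℕ) (c T : ℝ) : L2Forms m →ₗ.[ℝ] L2Forms m :=
  gaffney (dT (modelFn m j c) (contDiff_modelFn m j c) T)

/-- The kernel of an unbounded operator, as a subspace of the ambient Hilbert space. -/
def kernel {H : Type*} [NormedAddCommGroup H] [InnerProductSpace ℝ H] (A : H →ₗ.[ℝ] H) :
    Submodule ℝ H :=
  (LinearMap.ker A.toFun).map A.domain.subtype

/-- `lam` is an eigenvalue of the unbounded operator `A`. -/
def IsEigenvalue {H : Type*} [NormedAddCommGroup H] [InnerProductSpace ℝ H] (A : H →ₗ.[ℝ] H)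
    (lam : ℝ) : Prop :=
  ∃ w : A.domain, w ≠ 0 ∧ A w = lam • (w : H)

/-- The form `exp(-T |Z'|² / 2 - T Z_n) e^1 ∧ … ∧ e^j`. -/
def groundState (m j : ℕ) (hj : j ≤ m) (T : ℝ) (Z : E m) : Lam m :=
  Real.exp (-(T / 2) * ∑ i : Fin m, Z i.castSucc ^ 2 - T * Z (Fin.last m)) •
    coords m (ExteriorAlgebra.ιMulti ℝ j
      fun i : Fin j => dualBasis m (i.castLE (hj.trans (Nat.le_succ m))))

end

end HalfSpaceWitten

/-!
The Witten Laplacian is handled through its action on an explicit space of test functions, so that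
neither its self-adjointness nor a separation of variables is needed.

The test functions are the complex polynomials times `exp (-T |Z'|² / 2 - s Z_n)`, `Re s > 0`. An
integration by parts (`IsWeakDT.inner_formLp_eq`, proved for arbitrary forms in the weak domain of
`d_T` with the help of cutoff functions) shows that a test form `u e^I` whose coefficient satisfies
the absolute boundary condition, which is `u = 0` on `Z_n = 0` together with the same condition for
the tangential derivatives if `n ∈ I`, and `(∂_n + T) u = 0` on `Z_n = 0` if `n ∉ I`, is in the
Gaffney domain, and that the Witten Laplacian acts on it by the scalar Schrödinger operator
`ham j I` (`formLp_mem_graph_wittenLaplacian`). Consequently the coefficients of an eigenform `w` are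
weak solutions of the scalar eigenvalue equation (`coeffPairing_ham`).

Now let `Φ_l(s)` be the integral of `w_I` against `(a · Z')^l exp (-T |Z'|² / 2 - s Z_n)`. Applying
`ham j I - lam` to this function yields `κ_l - s²` times the function, up to a multiple of the one
of degree `l - 2`, where `κ_l = T² + 2 T (l + q) - lam` and `q` counts the tangential directions in
which `I` differs from `{1, …, j}`. A combination of the functions with parameters `s` and `t`
satisfies the boundary condition; so the pairings
`Ψ_l(s) = (κ_l - s²) Φ_l(s) - l (l - 1) |a|² Φ_{l - 2}(s)` satisfy `Ψ_l(s) = Ψ_l(t)` if `n ∈ I`, and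
`(T - t) Ψ_l(s) = (T - s) Ψ_l(t)` if `n ∉ I`. If `lam < 2 T` and `l + q ≥ 1`, then `κ_l > T²`, and
`t = √κ_l` is an admissible parameter other than `T` at which, inductively, `Ψ_l(t) = 0`; hence
`Ψ_l = 0`. If `l = q = 0`, the zero of `κ_0 - t²` may lie on the imaginary axis, and `Ψ_0` vanishes
there in the limit, because the Laplace transform of a square integrable function grows more slowly
than `1 / Re t`. The only exception is `lam = 0`, `I = {1, …, j}`, where the zero is `t = T` and the
ground state lives; there it is enough to know that `Φ_0(2 T) = 0`, which is a single linear
condition on `w`. So `Φ_l(s) = 0` whenever `s²` is none of the `κ_{l'}`, in particular on some line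
`Re s = ρ`. By the injectivity of the Fourier transform the test functions with parameters on a line
are complete (`eq_zero_of_coeffPairing_eq_zero`), whence `w = 0` (`eq_zero_of_mem_graph_of_lt`).

This excludes nonzero eigenvalues less than `2 T`, and shows that a harmonic form is determined by
one inner product, which does not vanish for the ground state.
-/

namespace HalfSpaceWitten

noncomputable section

open MeasureTheory TopologicalSpace
open scoped ContDiff InnerProductSpace Distributions

/-! ### Exterior multiplication and its transpose -/

/-- Exterior multiplication `e^i ∧ ·` in coordinates. -/
def extMul {m : ℕ} (i : Fin (m + 1)) : Lam m →ₗ[ℝ] Lam m :=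
  wedge m (EuclideanSpace.proj i)

/-- The transpose of `extMul i`, that is, the contraction with the vector `e_i`. -/
def contr {m : ℕ} (i : Fin (m + 1)) : Lam m →ₗ[ℝ] Lam m :=
  LinearMap.adjoint (extMul i)

/-- The basis covector `e^I` in coordinates. -/
abbrev basisVec {m : ℕ} (I : Finset (Fin (m + 1))) : Lam m := EuclideanSpace.single I 1

theorem coe_proj_eq_dualBasis {m : ℕ} (i : Fin (m + 1)) :
    ((EuclideanSpace.proj i : E m →L[ℝ] ℝ) : Module.Dual ℝ (E m)) = dualBasis m i := by
  ext v
  rw [dualBasis, Module.Basis.coe_dualBasis, Module.Basis.coord_apply,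
    OrthonormalBasis.coe_toBasis_repr_apply]
  simp

theorem coords_basis {m : ℕ} (I : Finset (Fin (m + 1))) :
    coords m ((dualBasis m).ExteriorAlgebra I) = basisVec I := by
  ext J
  simp [coords, Finsupp.single_apply, eq_comm]

theorem coords_symm_basisVec {m : ℕ} (I : Finset (Fin (m + 1))) :
    (coords m).symm (basisVec I) = (dualBasis m).ExteriorAlgebra I := by
  rw [LinearEquiv.symm_apply_eq, coords_basis]

theorem extMul_apply {m : ℕ} (i : Fin (m + 1)) (η : Lam m) :
    extMul i η = coords m (ExteriorAlgebra.ι ℝ (dualBasis m i) * (coords m).symm η) := by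
  rw [← coe_proj_eq_dualBasis]
  rfl

theorem ι_eq_basis {m : ℕ} (i : Fin (m + 1)) :
    ExteriorAlgebra.ι ℝ (dualBasis m i) = (dualBasis m).ExteriorAlgebra {i} := by
  rw [ExteriorAlgebra.basis_apply_ofCard (n := 1) _ (Finset.card_singleton i)]
  simp only [ExteriorAlgebra.ιMulti_family, ExteriorAlgebra.ιMulti_apply]
  simp [Set.powersetCard.ofFinEmbEquiv_symm_apply, Set.powersetCard.ofCard]

theorem wedge_eq_sum {m : ℕ} (ξ : E m →L[ℝ] ℝ) (η : Lam m) :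
    wedge m ξ η = ∑ i, ξ (EuclideanSpace.single i 1) • extMul i η := by
  have h : ξ = ∑ i, ξ (EuclideanSpace.single i 1) •
      (EuclideanSpace.proj i : E m →L[ℝ] ℝ) := by
    ext v
    conv_lhs => rw [← (EuclideanSpace.basisFun (Fin (m + 1)) ℝ).sum_repr v]
    simp [mul_comm]
  conv_lhs => rw [h]
  simp [extMul]

theorem extMul_anticomm {m : ℕ} (i k : Fin (m + 1)) (η : Lam m) :
    extMul i (extMul k η) = -extMul k (extMul i η) := by
  simp only [extMul_apply, LinearEquiv.symm_apply_apply, ← map_neg]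
  congr 1
  rw [← mul_assoc, ← mul_assoc, ← neg_mul]
  congr 1
  rw [eq_neg_iff_add_eq_zero]
  exact ExteriorAlgebra.ι_add_mul_swap _ _

theorem exists_sign_extMul {m : ℕ} (i : Fin (m + 1)) (I : Finset (Fin (m + 1))) :
    ∃ ε : ℝ, extMul i (basisVec I) = ε • basisVec (insert i I) ∧
      (i ∈ I → ε = 0) ∧ (i ∉ I → ε * ε = 1) := by
  have hs : ((dualBasis m).ExteriorAlgebra {i} : ExtAlg m)
      = (dualBasis m).ExteriorAlgebra
        (Set.powersetCard.ofCard (Finset.card_singleton i)).val := rfl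
  have ht : ((dualBasis m).ExteriorAlgebra I : ExtAlg m)
      = (dualBasis m).ExteriorAlgebra
        (Set.powersetCard.ofCard (rfl : I.card = I.card)).val := rfl
  by_cases hi : i ∈ I
  · refine ⟨0, ?_, fun _ => rfl, fun h => (h hi).elim⟩
    rw [extMul_apply, coords_symm_basisVec, ι_eq_basis, hs, ht,
      ExteriorAlgebra.basis_mul_of_not_disjoint]
    · simp
    · simpa using hi
  · have hd : Disjoint (Set.powersetCard.ofCard (Finset.card_singleton i)).val
        (Set.powersetCard.ofCard (rfl : I.card = I.card)).val := by simpa using hi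
    refine ⟨((Equiv.Perm.sign (Set.powersetCard.permOfDisjoint hd) : ℤ) : ℝ), ?_,
      fun h => (hi h).elim, fun _ => ?_⟩
    · rw [extMul_apply, coords_symm_basisVec, ι_eq_basis, hs, ht,
        ExteriorAlgebra.basis_mul_of_disjoint _ _ _ hd]
      have hu : (Set.powersetCard.disjUnion hd : Finset (Fin (m + 1))) = insert i I := by
        ext k
        simp [Set.powersetCard.coe_disjUnion]
      rw [hu, Units.smul_def, ← Int.cast_smul_eq_zsmul ℝ, map_smul, coords_basis]
    · rw [← Int.cast_mul, ← Units.val_mul, Int.units_mul_self]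
      simp

/-- The coefficient of `e^{I ∪ {i}}` in `e^i ∧ e^I`: a sign if `i ∉ I`, and `0` if `i ∈ I`. -/
def extSign {m : ℕ} (i : Fin (m + 1)) (I : Finset (Fin (m + 1))) : ℝ :=
  (exists_sign_extMul i I).choose

theorem extMul_basisVec {m : ℕ} (i : Fin (m + 1)) (I : Finset (Fin (m + 1))) :
    extMul i (basisVec I) = extSign i I • basisVec (insert i I) :=
  (exists_sign_extMul i I).choose_spec.1

theorem extSign_of_mem {m : ℕ} {i : Fin (m + 1)} {I : Finset (Fin (m + 1))} (h : i ∈ I) :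
    extSign i I = 0 :=
  (exists_sign_extMul i I).choose_spec.2.1 h

theorem extSign_mul_self {m : ℕ} {i : Fin (m + 1)} {I : Finset (Fin (m + 1))} (h : i ∉ I) :
    extSign i I * extSign i I = 1 :=
  (exists_sign_extMul i I).choose_spec.2.2 h

theorem extMul_basisVec_of_mem {m : ℕ} {i : Fin (m + 1)} {I : Finset (Fin (m + 1))}
    (h : i ∈ I) : extMul i (basisVec I) = 0 := by
  rw [extMul_basisVec, extSign_of_mem h, zero_smul]

theorem contr_basisVec {m : ℕ} (i : Fin (m + 1)) (J : Finset (Fin (m + 1))) :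
    contr i (basisVec J) =
      if i ∈ J then extSign i (J.erase i) • basisVec (J.erase i) else 0 := by
  ext I
  have h1 : (contr i (basisVec J)) I = ⟪basisVec I, contr i (basisVec J)⟫_ℝ := by
    rw [EuclideanSpace.inner_single_left]
    simp
  rw [h1, contr, LinearMap.adjoint_inner_right, extMul_basisVec]
  rw [inner_smul_left, EuclideanSpace.inner_single_left]
  by_cases hJ : i ∈ J
  · rw [if_pos hJ]
    by_cases hI : i ∈ I
    · have : I ≠ J.erase i := by rintro rfl; simp at hI
      simp [extSign_of_mem hI, this]
    · by_cases hIJ : I = J.erase i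
      · subst hIJ
        simp [Finset.insert_erase hJ]
      · have : insert i I ≠ J := by
          rintro rfl
          exact hIJ (Finset.erase_insert hI).symm
        simp [this, hIJ]
  · have : insert i I ≠ J := by
      rintro rfl
      exact hJ (Finset.mem_insert_self _ _)
    simp [hJ, this]

theorem contr_basisVec_of_notMem {m : ℕ} {i : Fin (m + 1)} {I : Finset (Fin (m + 1))}
    (h : i ∉ I) : contr i (basisVec I) = 0 := by
  rw [contr_basisVec, if_neg h]

theorem extMul_contr_basisVec {m : ℕ} (i : Fin (m + 1)) (I : Finset (Fin (m + 1))) :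
    extMul i (contr i (basisVec I)) = if i ∈ I then basisVec I else 0 := by
  rw [contr_basisVec]
  split_ifs with h
  · rw [map_smul, extMul_basisVec, smul_smul, extSign_mul_self (Finset.notMem_erase i I),
      one_smul, Finset.insert_erase h]
  · simp

theorem contr_extMul_basisVec {m : ℕ} (i : Fin (m + 1)) (I : Finset (Fin (m + 1))) :
    contr i (extMul i (basisVec I)) = if i ∈ I then 0 else basisVec I := by
  split_ifs with h
  · rw [extMul_basisVec_of_mem h, map_zero]
  · rw [extMul_basisVec, map_smul, contr_basisVec, if_pos (Finset.mem_insert_self i I),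
      Finset.erase_insert h, smul_smul, extSign_mul_self h, one_smul]

/-- The signs of `extMul i ∘ extMul k` and `extMul k ∘ extMul i` are opposite. -/
theorem extSign_anticomm {m : ℕ} (i k : Fin (m + 1)) (I : Finset (Fin (m + 1))) :
    extSign k I * extSign i (insert k I) = -(extSign i I * extSign k (insert i I)) := by
  have h := extMul_anticomm i k (basisVec I)
  rw [extMul_basisVec, map_smul, extMul_basisVec, extMul_basisVec, map_smul, extMul_basisVec,
    smul_smul, smul_smul, Finset.insert_comm k i I, ← neg_smul] at h
  have := congrArg (fun v : Lam m => v (insert i (insert k I))) h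
  simpa using this

/-- The Clifford relation `ι_i (e^k ∧ η) + e^k ∧ ι_i η = δ_{ik} η`. -/
theorem contr_extMul_add {m : ℕ} (i k : Fin (m + 1)) (η : Lam m) :
    contr i (extMul k η) + extMul k (contr i η) = if i = k then η else 0 := by
  have key : ∀ I : Finset (Fin (m + 1)),
      contr i (extMul k (basisVec I)) + extMul k (contr i (basisVec I)) =
        if i = k then basisVec I else 0 := by
    intro I
    split_ifs with hik
    · subst hik
      rw [extMul_contr_basisVec, contr_extMul_basisVec]
      split_ifs <;> simp
    · by_cases hi : i ∈ I
      · by_cases hk : k ∈ I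
        · rw [extMul_basisVec_of_mem hk, contr_basisVec, if_pos hi, map_smul,
            extMul_basisVec_of_mem (Finset.mem_erase.2 ⟨Ne.symm hik, hk⟩)]
          simp
        · obtain ⟨I₀, hI₀, rfl⟩ : ∃ I₀, i ∉ I₀ ∧ insert i I₀ = I :=
            ⟨I.erase i, Finset.notMem_erase i I, Finset.insert_erase hi⟩
          have hk0 : k ∉ I₀ := fun h => hk (Finset.mem_insert_of_mem h)
          have hi1 : i ∉ insert k I₀ := by simp [hik, hI₀]
          rw [extMul_basisVec, map_smul, contr_basisVec, contr_basisVec, if_pos hi,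
            if_pos (by simp), Finset.erase_insert hI₀, Finset.insert_comm,
            Finset.erase_insert hi1, map_smul, extMul_basisVec, smul_smul, smul_smul, ← add_smul]
          have h1 := extSign_anticomm i k I₀
          have h2 := extSign_mul_self hI₀
          have h3 := extSign_mul_self hi1
          have : extSign k (insert i I₀) * extSign i (insert k I₀)
              + extSign i I₀ * extSign k I₀ = 0 := by
            linear_combination extSign i I₀ * extSign i (insert k I₀) * h1
              - extSign k (insert i I₀) * extSign i (insert k I₀) * h2
              - extSign i I₀ * extSign k I₀ * h3
          rw [this, zero_smul]
      · have h1 : i ∉ insert k I := by simp [hik, hi]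
        rw [contr_basisVec_of_notMem hi, extMul_basisVec, map_smul, contr_basisVec_of_notMem h1]
        simp
  have h2 : contr i ∘ₗ extMul k + extMul k ∘ₗ contr i =
      (if i = k then LinearMap.id else 0 : Lam m →ₗ[ℝ] Lam m) := by
    refine (EuclideanSpace.basisFun (Finset (Fin (m + 1))) ℝ).toBasis.ext fun I => ?_
    have := key I
    split_ifs at this ⊢ with h <;> simpa [h] using this
  have h3 := LinearMap.congr_fun h2 η
  split_ifs at h3 ⊢ with h <;> simpa [h] using h3

/-- The index set `{1, …, j}` of the negative directions. -/
def negSet (m j : ℕ) : Finset (Fin (m + 1)) := Finset.univ.filter fun i => i.val < j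

theorem coords_ιMulti {m j : ℕ} (hj : j ≤ m) :
    coords m (ExteriorAlgebra.ιMulti ℝ j
      fun i : Fin j => dualBasis m (i.castLE (hj.trans (Nat.le_succ m)))) =
      basisVec (negSet m j) := by
  have hle := hj.trans (Nat.le_succ m)
  have himg : negSet m j = Finset.univ.image (Fin.castLE hle) := by
    ext i
    simp only [negSet, Finset.mem_filter, Finset.mem_univ, true_and, Finset.mem_image]
    exact ⟨fun h => ⟨⟨i, h⟩, rfl⟩, by rintro ⟨k, rfl⟩; exact k.2⟩
  have hcard : (negSet m j).card = j := by
    rw [himg, Finset.card_image_of_injective _ (Fin.castLE_injective hle)]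
    simp
  rw [← coords_basis, ExteriorAlgebra.basis_apply_ofCard _ hcard]
  congr 1
  simp only [ExteriorAlgebra.ιMulti_family]
  congr 1
  funext i
  simp only [Function.comp, Set.powersetCard.ofFinEmbEquiv_symm_apply]
  congr 1
  have := Finset.orderEmbOfFin_unique hcard (f := Fin.castLE hle)
    (fun x => by rw [himg]; exact Finset.mem_image_of_mem _ (Finset.mem_univ _))
    (Fin.strictMono_castLE hle)
  exact congrFun this i

/-! ### The test space: polynomials times Gaussians times exponentials -/

/-- A product of integrable functions of the coordinates is integrable on the half-space. -/
theorem integrable_prod_coord {m : ℕ} {f : Fin m → ℝ → ℝ} {g : ℝ → ℝ}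
    (hf : ∀ i, Integrable (f i)) (hg : IntegrableOn g (Set.Ioi 0)) :
    Integrable (fun Z : E m => (∏ i, f i (Z i.castSucc)) * g (Z (Fin.last m))) (μ m) := by
  let h : Fin (m + 1) → ℝ → ℝ := Fin.snoc f ((Set.Ioi 0).indicator g)
  have hh : ∀ i, Integrable (h i) := by
    intro i
    refine Fin.lastCases ?_ (fun i => ?_) i
    · simpa [h] using (integrable_indicator_iff measurableSet_Ioi).2 hg
    · simpa [h] using hf i
  have h1 : Integrable (fun x : Fin (m + 1) → ℝ => ∏ i, h i (x i)) := Integrable.fintype_prod hh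
  have h2 : Integrable (fun Z : E m => ∏ i, h i (Z i)) := by
    rw [← (PiLp.volume_preserving_toLp (Fin (m + 1))).integrable_comp_emb
      (MeasurableEquiv.toLp 2 _).measurableEmbedding]
    exact h1
  rw [μ, ← IntegrableOn, ← integrable_indicator_iff (halfSpace m).isOpen.measurableSet]
  refine h2.congr (Filter.Eventually.of_forall fun Z => ?_)
  simp only [Fin.prod_univ_castSucc, h, Fin.snoc_castSucc, Fin.snoc_last]
  by_cases hZ : 0 < Z (Fin.last m)
  · rw [Set.indicator_of_mem (by exact hZ), Set.indicator_of_mem (by exact hZ)]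
  · rw [Set.indicator_of_notMem (by exact hZ), Set.indicator_of_notMem (by exact hZ), mul_zero]

theorem ae_pos_last (m : ℕ) : ∀ᵐ Z ∂(μ m), 0 < Z (Fin.last m) :=
  ae_restrict_mem (halfSpace m).isOpen.measurableSet

/-- The function `exp (-T |Z'|² / 2 - s Z_n)`, for a complex parameter `s`. -/
def gaussExp {m : ℕ} (T : ℝ) (s : ℂ) (Z : E m) : ℂ :=
  Complex.exp (-((T / 2 : ℝ) : ℂ) * ∑ i : Fin m, (Z i.castSucc : ℂ) ^ 2
    - s * (Z (Fin.last m) : ℂ))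

/-- A polynomial times `gaussExp T s`. -/
def polyExp {m : ℕ} (T : ℝ) (P : MvPolynomial (Fin (m + 1)) ℂ) (s : ℂ) (Z : E m) : ℂ :=
  MvPolynomial.eval (fun i => (Z i : ℂ)) P * gaussExp T s Z

theorem norm_gaussExp {m : ℕ} (T : ℝ) (s : ℂ) (Z : E m) :
    ‖gaussExp T s Z‖ = (∏ i : Fin m, Real.exp (-(T / 2) * Z i.castSucc ^ 2)) *
      Real.exp (-s.re * Z (Fin.last m)) := by
  rw [gaussExp, Complex.norm_exp, ← Real.exp_sum, ← Real.exp_add]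
  congr 1
  rw [Complex.sub_re, ← Finset.mul_sum]
  have : ∑ i : Fin m, (Z i.castSucc : ℂ) ^ 2 = ((∑ i : Fin m, Z i.castSucc ^ 2 : ℝ) : ℂ) := by
    push_cast; rfl
  rw [this, ← Complex.ofReal_neg, ← Complex.ofReal_mul, Complex.ofReal_re, Complex.re_mul_ofReal]
  ring

theorem gaussExp_ofReal {m : ℕ} (T s : ℝ) (Z : E m) :
    gaussExp T s Z = ((Real.exp (-(T / 2) * ∑ i : Fin m, Z i.castSucc ^ 2
      - s * Z (Fin.last m)) : ℝ) : ℂ) := by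
  rw [gaussExp]
  push_cast
  rfl

theorem contDiff_ofReal_coord {m : ℕ} (i : Fin (m + 1)) :
    ContDiff ℝ ∞ (fun Z : E m => (Z i : ℂ)) :=
  Complex.ofRealCLM.contDiff.comp (EuclideanSpace.proj (𝕜 := ℝ) i).contDiff

theorem contDiff_gaussExp {m : ℕ} (T : ℝ) (s : ℂ) : ContDiff ℝ ∞ (gaussExp (m := m) T s) := by
  unfold gaussExp
  refine ContDiff.cexp (ContDiff.sub (contDiff_const.mul (ContDiff.sum fun i _ => ?_))
    (contDiff_const.mul (contDiff_ofReal_coord _)))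
  exact (contDiff_ofReal_coord _).pow 2

theorem contDiff_polyVal {m : ℕ} (P : MvPolynomial (Fin (m + 1)) ℂ) :
    ContDiff ℝ ∞ (fun Z : E m => MvPolynomial.eval (fun i => (Z i : ℂ)) P) := by
  induction P using MvPolynomial.induction_on with
  | C a => simpa using contDiff_const
  | add p q hp hq => simpa using hp.add hq
  | mul_X p i hp => simpa using hp.mul (contDiff_ofReal_coord i)

theorem contDiff_polyExp {m : ℕ} (T : ℝ) (P : MvPolynomial (Fin (m + 1)) ℂ) (s : ℂ) :
    ContDiff ℝ ∞ (polyExp T P s) :=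
  (contDiff_polyVal P).mul (contDiff_gaussExp T s)

theorem integrable_pow_mul_gauss {a : ℝ} (ha : 0 < a) (k : ℕ) :
    Integrable fun x : ℝ => x ^ k * Real.exp (-a * x ^ 2) := by
  simpa using integrable_rpow_mul_exp_neg_mul_sq ha (s := k) (by
    have : (0 : ℝ) ≤ k := k.cast_nonneg
    linarith)

theorem integrableOn_pow_mul_exp {a : ℝ} (ha : 0 < a) (k : ℕ) :
    IntegrableOn (fun x : ℝ => x ^ k * Real.exp (-a * x)) (Set.Ioi 0) := by
  simpa using integrableOn_rpow_mul_exp_neg_mul_rpow (p := 1) (s := k) (by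
    have : (0 : ℝ) ≤ k := k.cast_nonneg
    linarith) one_pos ha

theorem memLp_polyExp {m : ℕ} {T : ℝ} (hT : 0 < T) (P : MvPolynomial (Fin (m + 1)) ℂ) {s : ℂ}
    (hs : 0 < s.re) : MemLp (polyExp T P s) 2 (μ m) := by
  have hmono : ∀ d : Fin (m + 1) →₀ ℕ,
      MemLp (fun Z : E m => (∏ i, (Z i : ℂ) ^ d i) * gaussExp T s Z) 2 (μ m) := by
    intro d
    have hc : Continuous (fun Z : E m => (∏ i, (Z i : ℂ) ^ d i) * gaussExp T s Z) :=
      (continuous_finsetProd _ fun i _ => (contDiff_ofReal_coord i).continuous.pow _).mul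
        (contDiff_gaussExp T s).continuous
    refine (memLp_two_iff_integrable_sq_norm hc.aestronglyMeasurable).2 ?_
    have h := integrable_prod_coord (m := m)
      (f := fun i x => x ^ (2 * d i.castSucc) * Real.exp (-T * x ^ 2))
      (g := fun x => x ^ (2 * d (Fin.last m)) * Real.exp (-(2 * s.re) * x))
      (fun i => integrable_pow_mul_gauss hT _) (integrableOn_pow_mul_exp (by linarith) _)
    refine h.congr (Filter.Eventually.of_forall fun Z => ?_)
    simp only [norm_mul, norm_prod, norm_pow, Complex.norm_real, Real.norm_eq_abs, norm_gaussExp,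
      Fin.prod_univ_castSucc, mul_pow, ← Finset.prod_pow]
    simp only [← pow_mul, ← Real.exp_nat_mul, Finset.prod_mul_distrib]
    have e1 : ∀ (x : ℝ) (k : ℕ), |x| ^ (k * 2) = x ^ (2 * k) := by
      intro x k
      rw [mul_comm, pow_mul, pow_mul, sq_abs]
    simp only [e1]
    have e2 : ∀ x : ℝ, Real.exp (((2 : ℕ) : ℝ) * (-(T / 2) * x ^ 2)) = Real.exp (-T * x ^ 2) := by
      intro x; congr 1; push_cast; ring
    have e3 : Real.exp (((2 : ℕ) : ℝ) * (-s.re * Z (Fin.last m)))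
        = Real.exp (-(2 * s.re) * Z (Fin.last m)) := by
      congr 1; push_cast; ring
    simp only [e2, e3]
    ring
  have : polyExp T P s = fun Z : E m =>
      ∑ d ∈ P.support, P.coeff d • ((∏ i, (Z i : ℂ) ^ d i) * gaussExp T s Z) := by
    funext Z
    rw [polyExp, MvPolynomial.eval_eq', Finset.sum_mul]
    simp [mul_assoc]
  rw [this]
  exact memLp_finsetSum _ fun d _ => (hmono d).const_smul (P.coeff d)

/-- The partial derivative `∂_i`. -/
def pd {m : ℕ} (i : Fin (m + 1)) (φ : E m → ℂ) (Z : E m) : ℂ :=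
  fderiv ℝ φ Z (EuclideanSpace.single i 1)

/-- The polynomial `∂_i P + P ∂_i q`, where `q = -T |Z'|² / 2 - s Z_n`. -/
def gradPoly {m : ℕ} (T : ℝ) (i : Fin (m + 1)) (P : MvPolynomial (Fin (m + 1)) ℂ) (s : ℂ) :
    MvPolynomial (Fin (m + 1)) ℂ :=
  MvPolynomial.pderiv i P -
    (if i = Fin.last m then MvPolynomial.C s else MvPolynomial.C (T : ℂ) * MvPolynomial.X i) * P

theorem pd_ofReal_coord {m : ℕ} (i k : Fin (m + 1)) (Z : E m) :
    pd i (fun Z : E m => (Z k : ℂ)) Z = if k = i then 1 else 0 := by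
  have : HasFDerivAt (fun Z : E m => (Z k : ℂ))
      (Complex.ofRealCLM ∘L (EuclideanSpace.proj (𝕜 := ℝ) k)) Z :=
    (Complex.ofRealCLM ∘L (EuclideanSpace.proj (𝕜 := ℝ) k : E m →L[ℝ] ℝ)).hasFDerivAt
  rw [pd, this.fderiv]
  by_cases h : k = i <;> simp [h]

theorem pd_add {m : ℕ} (i : Fin (m + 1)) {φ ψ : E m → ℂ} (hφ : ContDiff ℝ ∞ φ)
    (hψ : ContDiff ℝ ∞ ψ) (Z : E m) :
    pd i (fun Z => φ Z + ψ Z) Z = pd i φ Z + pd i ψ Z := by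
  rw [pd, fderiv_fun_add (hφ.differentiable (by simp) Z) (hψ.differentiable (by simp) Z)]
  rfl

theorem pd_mul {m : ℕ} (i : Fin (m + 1)) {φ ψ : E m → ℂ} (hφ : ContDiff ℝ ∞ φ)
    (hψ : ContDiff ℝ ∞ ψ) (Z : E m) :
    pd i (fun Z => φ Z * ψ Z) Z = pd i φ Z * ψ Z + φ Z * pd i ψ Z := by
  rw [pd, fderiv_fun_mul (hφ.differentiable (by simp) Z) (hψ.differentiable (by simp) Z)]
  simp [pd]
  ring

theorem pd_const_smul {m : ℕ} (i : Fin (m + 1)) (c : ℂ) {φ : E m → ℂ} (hφ : ContDiff ℝ ∞ φ)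
    (Z : E m) : pd i (fun Z => c • φ Z) Z = c • pd i φ Z := by
  rw [pd, fderiv_fun_const_smul (hφ.differentiable (by simp) Z)]
  rfl

theorem pd_polyVal {m : ℕ} (i : Fin (m + 1)) (P : MvPolynomial (Fin (m + 1)) ℂ) (Z : E m) :
    pd i (fun Z : E m => MvPolynomial.eval (fun i => (Z i : ℂ)) P) Z =
      MvPolynomial.eval (fun i => (Z i : ℂ)) (MvPolynomial.pderiv i P) := by
  induction P using MvPolynomial.induction_on with
  | C a => simp [pd]
  | add p q hp hq =>
    simp only [map_add]
    rw [pd_add i (contDiff_polyVal p) (contDiff_polyVal q), hp, hq]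
  | mul_X p k hp =>
    simp only [map_mul, MvPolynomial.eval_X]
    rw [pd_mul i (contDiff_polyVal p) (contDiff_ofReal_coord k), hp, pd_ofReal_coord,
      MvPolynomial.pderiv_mul, map_add, map_mul, map_mul, MvPolynomial.pderiv_X,
      MvPolynomial.eval_X, Pi.single_apply]
    split_ifs <;> simp_all

theorem pd_gaussExp {m : ℕ} (T : ℝ) (i : Fin (m + 1)) (s : ℂ) (Z : E m) :
    pd i (gaussExp T s) Z =
      -(if i = Fin.last m then s else (T : ℂ) * (Z i : ℂ)) * gaussExp T s Z := by
  have hk : ∀ k : Fin (m + 1), HasFDerivAt (fun Z : E m => (Z k : ℂ))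
      (Complex.ofRealCLM ∘L (EuclideanSpace.proj (𝕜 := ℝ) k)) Z := fun k =>
    (Complex.ofRealCLM ∘L (EuclideanSpace.proj (𝕜 := ℝ) k : E m →L[ℝ] ℝ)).hasFDerivAt
  have h1 := ((HasFDerivAt.fun_sum (u := Finset.univ)
    fun (k : Fin m) _ => (hk k.castSucc).pow 2).const_mul
      (-((T / 2 : ℝ) : ℂ))).sub ((hk (Fin.last m)).const_mul s)
  have h2 := h1.cexp
  have h3 : pd i (gaussExp T s) Z = _ := congrArg (fun L => L (EuclideanSpace.single i (1 : ℝ)))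
    h2.fderiv
  rw [h3]
  refine Fin.lastCases ?_ (fun k => ?_) i
  · simp [gaussExp, (Fin.castSucc_lt_last _).ne]
    ring
  · have : ∀ x : Fin m, (x.castSucc = k.castSucc) = (x = k) := by simp
    simp [gaussExp, PiLp.single_apply, (Fin.castSucc_lt_last _).ne, (Fin.castSucc_lt_last _).ne',
      apply_ite Complex.ofReal]
    ring

theorem pd_polyExp {m : ℕ} (T : ℝ) (i : Fin (m + 1)) (P : MvPolynomial (Fin (m + 1)) ℂ) (s : ℂ) :
    pd i (polyExp T P s) = polyExp T (gradPoly T i P s) s := by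
  funext Z
  have := pd_mul i (contDiff_polyVal P) (contDiff_gaussExp T s) Z
  rw [pd_polyVal, pd_gaussExp] at this
  refine this.trans ?_
  rw [polyExp, gradPoly]
  split_ifs <;> simp <;> ring

/-- The space of test functions: the span of the functions `polyExp T P s` with `0 < Re s`. -/
def testSpace (m : ℕ) (T : ℝ) : Submodule ℂ (E m → ℂ) :=
  Submodule.span ℂ {φ | ∃ (P : MvPolynomial (Fin (m + 1)) ℂ) (s : ℂ), 0 < s.re ∧ φ = polyExp T P s}

theorem testSpace_induction {m : ℕ} {T : ℝ} {p : (E m → ℂ) → Prop}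
    (gen : ∀ P s, 0 < s.re → p (polyExp T P s)) (zero : p 0)
    (add : ∀ φ ψ, φ ∈ testSpace m T → ψ ∈ testSpace m T → p φ → p ψ → p (φ + ψ))
    (smul : ∀ (c : ℂ) φ, φ ∈ testSpace m T → p φ → p (c • φ)) {φ : E m → ℂ}
    (hφ : φ ∈ testSpace m T) : p φ := by
  induction hφ using Submodule.span_induction with
  | mem φ h => obtain ⟨P, s, hs, rfl⟩ := h; exact gen P s hs
  | zero => exact zero
  | add φ ψ hφ hψ h1 h2 => exact add φ ψ hφ hψ h1 h2
  | smul c φ hφ h => exact smul c φ hφ h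

theorem polyExp_mem {m : ℕ} (T : ℝ) (P : MvPolynomial (Fin (m + 1)) ℂ) {s : ℂ} (hs : 0 < s.re) :
    polyExp T P s ∈ testSpace m T :=
  Submodule.subset_span ⟨P, s, hs, rfl⟩

theorem contDiff_of_mem_testSpace {m : ℕ} {T : ℝ} {φ : E m → ℂ} (hφ : φ ∈ testSpace m T) :
    ContDiff ℝ ∞ φ := by
  refine testSpace_induction (fun P s _ => contDiff_polyExp T P s) contDiff_const
    (fun φ ψ _ _ h1 h2 => h1.add h2) (fun c φ _ h => ?_) hφ
  exact contDiff_const.smul h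

theorem memLp_of_mem_testSpace {m : ℕ} {T : ℝ} (hT : 0 < T) {φ : E m → ℂ}
    (hφ : φ ∈ testSpace m T) : MemLp φ 2 (μ m) :=
  testSpace_induction (p := fun φ => MemLp φ 2 (μ m)) (fun P _ hs => memLp_polyExp hT P hs)
    MemLp.zero
    (fun _ _ _ _ h1 h2 => h1.add h2) (fun c _ _ h => h.const_smul c) hφ

theorem pd_mem_testSpace {m : ℕ} {T : ℝ} (i : Fin (m + 1)) {φ : E m → ℂ}
    (hφ : φ ∈ testSpace m T) : pd i φ ∈ testSpace m T := by
  refine testSpace_induction (p := fun φ => pd i φ ∈ testSpace m T) (fun P s hs => ?_) ?_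
    (fun φ ψ hφ hψ h1 h2 => ?_) (fun c φ hφ h => ?_) hφ
  · rw [pd_polyExp]
    exact polyExp_mem T _ hs
  · have : pd i (0 : E m → ℂ) = 0 := by
      funext Z
      simp [pd]
    rw [this]
    exact Submodule.zero_mem _
  · have : pd i (φ + ψ) = pd i φ + pd i ψ := funext fun Z =>
      pd_add i (contDiff_of_mem_testSpace hφ) (contDiff_of_mem_testSpace hψ) Z
    rw [this]
    exact Submodule.add_mem _ h1 h2
  · have : pd i (c • φ) = c • pd i φ := funext fun Z =>
      pd_const_smul i c (contDiff_of_mem_testSpace hφ) Z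
    rw [this]
    exact Submodule.smul_mem _ c h

theorem coord_mul_mem_testSpace {m : ℕ} {T : ℝ} (i : Fin (m + 1)) {φ : E m → ℂ}
    (hφ : φ ∈ testSpace m T) : (fun Z => (Z i : ℂ) * φ Z) ∈ testSpace m T := by
  refine testSpace_induction (p := fun φ => (fun Z => (Z i : ℂ) * φ Z) ∈ testSpace m T)
    (fun P s hs => ?_) ?_ (fun φ ψ hφ hψ h1 h2 => ?_) (fun c φ hφ h => ?_) hφ
  · have : (fun Z : E m => (Z i : ℂ) * polyExp T P s Z)
        = polyExp T (MvPolynomial.X i * P) s := by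
      funext Z
      simp [polyExp, mul_assoc]
    rw [this]
    exact polyExp_mem T _ hs
  · simp only [Pi.zero_apply, mul_zero]
    exact Submodule.zero_mem _
  · simp only [Pi.add_apply, mul_add]
    exact Submodule.add_mem _ h1 h2
  · simp only [Pi.smul_apply, mul_smul_comm]
    exact Submodule.smul_mem _ c h

/-- The operator `∂_i` on the test space. -/
def diff {m : ℕ} {T : ℝ} (i : Fin (m + 1)) : testSpace m T →ₗ[ℂ] testSpace m T where
  toFun φ := ⟨pd i φ, pd_mem_testSpace i φ.2⟩
  map_add' φ ψ := Subtype.ext <| funext fun Z =>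
    pd_add i (contDiff_of_mem_testSpace φ.2) (contDiff_of_mem_testSpace ψ.2) Z
  map_smul' c φ := Subtype.ext <| funext fun Z =>
    pd_const_smul i c (contDiff_of_mem_testSpace φ.2) Z

/-- Multiplication by the coordinate `Z_i` on the test space. -/
def coordMul {m : ℕ} {T : ℝ} (i : Fin (m + 1)) : testSpace m T →ₗ[ℂ] testSpace m T where
  toFun φ := ⟨fun Z => (Z i : ℂ) * (φ : E m → ℂ) Z, coord_mul_mem_testSpace i φ.2⟩
  map_add' φ ψ := Subtype.ext <| funext fun Z => by simp [mul_add]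
  map_smul' c φ := Subtype.ext <| funext fun Z => by simp [mul_left_comm]

/-- `polyExp T P s` as an element of the test space. -/
def polyTest {m : ℕ} (T : ℝ) (P : MvPolynomial (Fin (m + 1)) ℂ) {s : ℂ} (hs : 0 < s.re) :
    testSpace m T :=
  ⟨polyExp T P s, polyExp_mem T P hs⟩

theorem diff_polyTest {m : ℕ} (T : ℝ) (i : Fin (m + 1)) (P : MvPolynomial (Fin (m + 1)) ℂ) {s : ℂ}
    (hs : 0 < s.re) : diff i (polyTest T P hs) = polyTest T (gradPoly T i P s) hs :=
  Subtype.ext (pd_polyExp T i P s)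

theorem coordMul_polyTest {m : ℕ} (T : ℝ) (i : Fin (m + 1)) (P : MvPolynomial (Fin (m + 1)) ℂ)
    {s : ℂ} (hs : 0 < s.re) :
    coordMul i (polyTest T P hs) = polyTest T (MvPolynomial.X i * P) hs :=
  Subtype.ext (funext fun Z => by simp [coordMul, polyTest, polyExp, mul_assoc])

theorem polyTest_add {m : ℕ} (T : ℝ) (P Q : MvPolynomial (Fin (m + 1)) ℂ) {s : ℂ}
    (hs : 0 < s.re) : polyTest T (P + Q) hs = polyTest T P hs + polyTest T Q hs :=
  Subtype.ext (funext fun Z => by simp [polyTest, polyExp, add_mul])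

theorem polyTest_C_mul {m : ℕ} (T : ℝ) (c : ℂ) (P : MvPolynomial (Fin (m + 1)) ℂ) {s : ℂ}
    (hs : 0 < s.re) : polyTest T (MvPolynomial.C c * P) hs = c • polyTest T P hs :=
  Subtype.ext (funext fun Z => by simp [polyTest, polyExp, mul_assoc])

/-- The canonical commutation relation. -/
theorem diff_coordMul {m : ℕ} {T : ℝ} (i k : Fin (m + 1)) (φ : testSpace m T) :
    diff i (coordMul k φ) = coordMul k (diff i φ) + if i = k then φ else 0 := by
  refine Subtype.ext (funext fun Z => ?_)
  have := pd_mul i (contDiff_ofReal_coord k) (contDiff_of_mem_testSpace φ.2) Z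
  rw [pd_ofReal_coord] at this
  refine this.trans ?_
  by_cases h : i = k
  · subst h
    simp [coordMul, diff, add_comm]
  · simp [coordMul, diff, h, Ne.symm h]

theorem diff_comm {m : ℕ} {T : ℝ} (i k : Fin (m + 1)) (φ : testSpace m T) :
    diff i (diff k φ) = diff k (diff i φ) := by
  refine Subtype.ext (funext fun Z => ?_)
  have hφ := contDiff_of_mem_testSpace φ.2
  have h1 : ∀ v w : E m, fderiv ℝ (fun Y => fderiv ℝ (φ : E m → ℂ) Y v) Z w =
      fderiv ℝ (fderiv ℝ (φ : E m → ℂ)) Z w v := by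
    intro v w
    have hd : DifferentiableAt ℝ (fderiv ℝ (φ : E m → ℂ)) Z :=
      (hφ.fderiv_right (m := 1) (by norm_cast)).differentiable (by simp) Z
    rw [fderiv_clm_apply hd (differentiableAt_const v)]
    simp
  have hsymm := ((contDiff_infty.1 hφ 2).contDiffAt (x := Z)).isSymmSndFDerivAt (by simp)
  exact ((h1 _ _).trans (hsymm _ _)).trans (h1 _ _).symm

/-- The test functions `φ` with `φ / Z_n` square integrable on the half-space; these vanish on the
boundary hyperplane `Z_n = 0`. -/
def bdrySpace (m : ℕ) (T : ℝ) : Submodule ℂ (testSpace m T) where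
  carrier := {φ | MemLp (fun Z => ((Z (Fin.last m))⁻¹ : ℝ) • (φ : E m → ℂ) Z) 2 (μ m)}
  zero_mem' := by
    simp only [Set.mem_ofPred_eq, ZeroMemClass.coe_zero, Pi.zero_apply, smul_zero]
    exact MemLp.zero
  add_mem' h1 h2 := by
    simpa only [Set.mem_ofPred_eq, Submodule.coe_add, Pi.add_apply, smul_add] using! h1.add h2
  smul_mem' c φ h := by
    have := h.const_smul c
    refine this.congr_norm ?_ (Filter.Eventually.of_forall fun Z => ?_)
    · exact (this.1).congr (Filter.Eventually.of_forall fun Z => by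
        simp [mul_left_comm])
    · simp [mul_left_comm]

/-- For equal polynomial factors, the difference of two exponentials vanishes on the boundary. -/
theorem polyTest_sub_mem_bdrySpace {m : ℕ} {T : ℝ} (hT : 0 < T)
    (P : MvPolynomial (Fin (m + 1)) ℂ) {s t : ℂ} (hs : 0 < s.re) (ht : 0 < t.re) :
    polyTest T P hs - polyTest T P ht ∈ bdrySpace m T := by
  have hmeas : AEStronglyMeasurable (fun Z : E m => ((Z (Fin.last m))⁻¹ : ℝ) •
      (polyTest T P hs - polyTest T P ht : testSpace m T).1 Z) (μ m) := by
    refine AEStronglyMeasurable.smul (𝕜 := ℝ) ?_ ?_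
    · exact ((EuclideanSpace.proj (𝕜 := ℝ) (Fin.last m)).continuous.measurable.inv
        ).aestronglyMeasurable
    · exact (contDiff_of_mem_testSpace (polyTest T P hs - polyTest T P ht).2
        ).continuous.aestronglyMeasurable
  -- a parameter with the smaller real part gives the larger exponential
  have key : ∀ r : ℂ, 0 < r.re → r.re ≤ s.re → r.re ≤ t.re →
      MemLp (fun Z : E m => ((Z (Fin.last m))⁻¹ : ℝ) •
        (polyTest T P hs - polyTest T P ht : testSpace m T).1 Z) 2 (μ m) := by
    intro r hr hrs hrt
    refine ((memLp_polyExp hT P hr).norm.const_mul ‖t - s‖).mono' hmeas ?_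
    filter_upwards [ae_pos_last m] with Z hZ
    have hexp : ‖Complex.exp (-s * (Z (Fin.last m) : ℂ)) - Complex.exp (-t * (Z (Fin.last m) : ℂ))‖
        ≤ ‖t - s‖ * Z (Fin.last m) * Real.exp (-r.re * Z (Fin.last m)) := by
      have hconv : Convex ℝ {ζ : ℂ | ζ.re ≤ -r.re * Z (Fin.last m)} :=
        convex_halfSpace_re_le _
      have := hconv.norm_image_sub_le_of_norm_deriv_le (𝕜 := ℂ) (f := Complex.exp)
        (C := Real.exp (-r.re * Z (Fin.last m)))
        (x := -t * (Z (Fin.last m) : ℂ)) (y := -s * (Z (Fin.last m) : ℂ))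
        (fun _ _ => Complex.differentiableAt_exp)
        (fun ζ hζ => by
          rw [Complex.deriv_exp, Complex.norm_exp]
          exact Real.exp_le_exp.2 hζ)
        (by
          simp only [Set.mem_ofPred_eq, Complex.re_mul_ofReal, Complex.neg_re]
          nlinarith)
        (by
          simp only [Set.mem_ofPred_eq, Complex.re_mul_ofReal, Complex.neg_re]
          nlinarith)
      refine this.trans (le_of_eq ?_)
      have h2 : -s * (Z (Fin.last m) : ℂ) - -t * (Z (Fin.last m) : ℂ)
          = (t - s) * (Z (Fin.last m) : ℂ) := by ring
      rw [h2, norm_mul, Complex.norm_real, Real.norm_of_nonneg hZ.le]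
      ring
    have hval : (polyTest T P hs - polyTest T P ht : testSpace m T).1 Z =
        MvPolynomial.eval (fun i => (Z i : ℂ)) P * gaussExp T 0 Z *
        (Complex.exp (-s * (Z (Fin.last m) : ℂ)) - Complex.exp (-t * (Z (Fin.last m) : ℂ))) := by
      simp only [polyTest, AddSubgroupClass.coe_sub, Pi.sub_apply, polyExp, gaussExp, mul_assoc,
        mul_sub, ← Complex.exp_add]
      simp [sub_eq_add_neg]
    have hr' : ‖polyExp T P r Z‖ = ‖MvPolynomial.eval (fun i => (Z i : ℂ)) P * gaussExp T 0 Z‖ *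
        Real.exp (-r.re * Z (Fin.last m)) := by
      rw [polyExp, norm_mul, norm_mul, norm_gaussExp, norm_gaussExp]
      simp [mul_assoc]
    rw [hval, norm_smul, norm_mul, hr', norm_inv, Real.norm_of_nonneg hZ.le,
      inv_mul_le_iff₀ hZ]
    calc _ ≤ _ := mul_le_mul_of_nonneg_left hexp (norm_nonneg _)
      _ = _ := by ring
  rcases le_total s.re t.re with h | h
  · exact key s hs le_rfl h
  · exact key t ht h le_rfl

/-! ### The differential on test forms -/

/-- The sign of the second derivative `∂_i² f` of the model function in a tangential direction. -/
def hessSign {m : ℕ} (j : ℕ) (i : Fin (m + 1)) : ℝ := if i.val < j then -1 else 1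

/-- Multiplication by `∂_i f` on the test space, where `f` is the model function. -/
def gradMul {m : ℕ} {T : ℝ} (j : ℕ) (i : Fin (m + 1)) : testSpace m T →ₗ[ℂ] testSpace m T :=
  if i = Fin.last m then LinearMap.id else (hessSign j i : ℂ) • coordMul i

theorem fderiv_modelFn {m : ℕ} (j : ℕ) (c : ℝ) (i : Fin (m + 1)) (Z : E m) :
    fderiv ℝ (modelFn m j c) Z (EuclideanSpace.single i 1) =
      if i = Fin.last m then 1 else hessSign j i * Z i := by
  have hk : ∀ k : Fin (m + 1), HasFDerivAt (fun Z : E m => Z k)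
      (EuclideanSpace.proj (𝕜 := ℝ) k) Z := fun k =>
    (EuclideanSpace.proj (𝕜 := ℝ) k : E m →L[ℝ] ℝ).hasFDerivAt
  have hsum : ∀ S : Finset (Fin m),
      HasFDerivAt (fun Z : E m => (2⁻¹ : ℝ) * ∑ i ∈ S, Z i.castSucc ^ 2) _ Z := fun S =>
    (HasFDerivAt.fun_sum (u := S) fun (k : Fin m) _ => (hk k.castSucc).pow 2).const_mul _
  have hE : modelFn m j c = fun Z => c - 2⁻¹ * ∑ i : Fin m with i.val < j, Z i.castSucc ^ 2
      + 2⁻¹ * ∑ i : Fin m with j ≤ i.val, Z i.castSucc ^ 2 + Z (Fin.last m) := by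
    funext Z
    rw [modelFn, div_eq_inv_mul, div_eq_inv_mul]
  have h1 :=
    (((hsum (Finset.univ.filter fun i => i.val < j)).const_sub c).add
      (hsum (Finset.univ.filter fun i => j ≤ i.val))).add (hk (Fin.last m))
  have h2 : fderiv ℝ (modelFn m j c) Z = _ :=
    (congrArg (fun g => fderiv ℝ g Z) hE).trans h1.fderiv
  rw [h2]
  refine Fin.lastCases ?_ (fun k => ?_) i
  · simp [(Fin.castSucc_lt_last _).ne]
  · have : ∀ x : Fin m, (x.castSucc = k.castSucc) = (x = k) := by simp
    simp only [hessSign, (Fin.castSucc_lt_last k).ne, if_false, Fin.val_castSucc]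
    by_cases hkj : k.val < j
    · simp [PiLp.single_apply, (Fin.castSucc_lt_last _).ne', hkj]
    · simp [PiLp.single_apply, (Fin.castSucc_lt_last _).ne', hkj, not_lt.1 hkj]

theorem re_gradMul {m : ℕ} {T : ℝ} (j : ℕ) (c : ℝ) (i : Fin (m + 1)) (φ : testSpace m T)
    (Z : E m) : ((gradMul j i φ).1 Z).re =
      fderiv ℝ (modelFn m j c) Z (EuclideanSpace.single i 1) * (φ.1 Z).re := by
  rw [fderiv_modelFn, gradMul]
  split_ifs with h
  · simp
  · simp [coordMul, mul_assoc]

/-- The operator `∂_i + T ∂_i f`, where `f` is the model function. -/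
def lower {m : ℕ} {T : ℝ} (j : ℕ) (i : Fin (m + 1)) : testSpace m T →ₗ[ℂ] testSpace m T :=
  diff i + (T : ℂ) • gradMul j i

/-- The formal adjoint `-∂_i + T ∂_i f` of `lower j i`. -/
def raise {m : ℕ} {T : ℝ} (j : ℕ) (i : Fin (m + 1)) : testSpace m T →ₗ[ℂ] testSpace m T :=
  -diff i + (T : ℂ) • gradMul j i

theorem memLp_re_smul {m : ℕ} {T : ℝ} (hT : 0 < T) (φ : testSpace m T) (η : Lam m) :
    MemLp (fun Z => (φ.1 Z).re • η) 2 (μ m) := by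
  have h := (memLp_of_mem_testSpace hT φ.2).re
  exact (((ContinuousLinearMap.id ℝ ℝ).smulRight η).comp_memLp' h)

/-- The square integrable form `(Re φ) η`, for a test function `φ` and a constant form `η`. -/
def formLp {m : ℕ} {T : ℝ} (hT : 0 < T) : testSpace m T →ₗ[ℝ] Lam m →ₗ[ℝ] L2Forms m :=
  LinearMap.mk₂ ℝ (fun φ η => (memLp_re_smul hT φ η).toLp _)
    (fun φ ψ η => by
      rw [← MemLp.toLp_add, MemLp.toLp_eq_toLp_iff]
      exact Filter.Eventually.of_forall fun Z => by simp [add_smul])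
    (fun c φ η => by
      rw [← MemLp.toLp_const_smul, MemLp.toLp_eq_toLp_iff]
      exact Filter.Eventually.of_forall fun Z => by simp [mul_smul])
    (fun φ η η' => by
      rw [← MemLp.toLp_add, MemLp.toLp_eq_toLp_iff]
      exact Filter.Eventually.of_forall fun Z => by simp)
    (fun c φ η => by
      rw [← MemLp.toLp_const_smul, MemLp.toLp_eq_toLp_iff]
      exact Filter.Eventually.of_forall fun Z => smul_comm _ _ _)

theorem coeFn_formLp {m : ℕ} {T : ℝ} (hT : 0 < T) (φ : testSpace m T) (η : Lam m) :
    formLp hT φ η =ᵐ[μ m] fun Z => (φ.1 Z).re • η :=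
  MemLp.coeFn_toLp (memLp_re_smul hT φ η)

theorem fderiv_re {m : ℕ} {T : ℝ} (i : Fin (m + 1)) (φ : testSpace m T) (Z : E m) :
    fderiv ℝ (fun Z => (φ.1 Z).re) Z (EuclideanSpace.single i 1) = ((diff i φ).1 Z).re := by
  have h := (contDiff_of_mem_testSpace φ.2).differentiable (by simp) Z
  have := (Complex.reCLM.hasFDerivAt.comp Z h.hasFDerivAt).fderiv
  have h2 : fderiv ℝ (fun Z => (φ.1 Z).re) Z = Complex.reCLM ∘L fderiv ℝ φ.1 Z := this
  rw [h2]
  rfl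

theorem contDiff_re {m : ℕ} {T : ℝ} (φ : testSpace m T) : ContDiff ℝ ∞ (fun Z => (φ.1 Z).re) :=
  Complex.reCLM.contDiff.comp (contDiff_of_mem_testSpace φ.2)

theorem fderiv_test_eq_zero {m : ℕ} (χ : 𝓓(halfSpace m, ℝ)) {Z : E m} (hZ : Z ∉ tsupport χ) :
    fderiv ℝ χ Z = 0 := by
  by_contra hne
  exact hZ (support_fderiv_subset ℝ (by simpa [Function.mem_support] using hne))

theorem integral_μ_eq {m : ℕ} (χ : 𝓓(halfSpace m, ℝ)) {g : E m → ℝ}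
    (hg : ∀ Z, Z ∉ tsupport χ → g Z = 0) : ∫ Z, g Z ∂(μ m) = ∫ Z, g Z := by
  refine setIntegral_eq_integral_of_forall_compl_eq_zero fun Z hZ => hg Z fun h => hZ ?_
  exact χ.tsupport_subset h

theorem integrable_of_test {m : ℕ} (χ : 𝓓(halfSpace m, ℝ)) {g : E m → ℝ} (hc : Continuous g)
    (hg : ∀ Z, Z ∉ tsupport χ → g Z = 0) (ν : Measure (E m)) [IsLocallyFiniteMeasure ν] :
    Integrable g ν :=
  hc.integrable_of_hasCompactSupport
    (HasCompactSupport.intro' χ.hasCompactSupport.isCompact (isClosed_tsupport _) hg)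

/-- Integration by parts against a test function with compact support in the open half-space. -/
theorem integral_test_mul_diff {m : ℕ} {T : ℝ} (χ : 𝓓(halfSpace m, ℝ)) (i : Fin (m + 1))
    (φ : testSpace m T) :
    ∫ Z, χ Z * ((diff i φ).1 Z).re ∂(μ m) =
      -∫ Z, fderiv ℝ χ Z (EuclideanSpace.single i 1) * (φ.1 Z).re ∂(μ m) := by
  have z0 : ∀ Z, Z ∉ tsupport χ → χ Z = 0 := fun Z h => image_eq_zero_of_notMem_tsupport h
  have z1 : ∀ Z, Z ∉ tsupport χ → χ Z * ((diff i φ).1 Z).re = 0 := fun Z h => by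
    rw [z0 Z h, zero_mul]
  have z2 : ∀ Z, Z ∉ tsupport χ →
      fderiv ℝ χ Z (EuclideanSpace.single i 1) * (φ.1 Z).re = 0 := fun Z h => by
    rw [fderiv_test_eq_zero χ h]; simp
  have hχ' : Continuous (fun Z => fderiv ℝ χ Z (EuclideanSpace.single i 1)) :=
    (χ.contDiff.continuous_fderiv (by simp)).clm_apply continuous_const
  rw [integral_μ_eq χ z1, integral_μ_eq χ z2]
  simp only [← fderiv_re]
  refine integral_mul_fderiv_eq_neg_fderiv_mul_of_integrable ?_ ?_ ?_ ?_ ?_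
  · exact integrable_of_test χ (hχ'.mul (contDiff_re φ).continuous) z2 _
  · simp only [fderiv_re]
    exact integrable_of_test χ (χ.continuous.mul (contDiff_re _).continuous) z1 _
  · exact integrable_of_test χ (χ.continuous.mul (contDiff_re φ).continuous)
      (fun Z h => by simp [z0 Z h]) _
  · exact fun Z _ => χ.contDiff.differentiable (by simp) Z
  · exact fun Z _ => (contDiff_re φ).differentiable (by simp) Z

/-- The form `d_T (φ η) = ∑ i, (∂_i φ + T ∂_i f φ) e^i ∧ η`. -/
def dForm {m : ℕ} {T : ℝ} (hT : 0 < T) (j : ℕ) (φ : testSpace m T) (η : Lam m) : L2Forms m :=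
  ∑ i, formLp hT (lower j i φ) (extMul i η)

theorem isWeakDT_formLp {m : ℕ} {T : ℝ} (hT : 0 < T) (j : ℕ) (c : ℝ) (φ : testSpace m T)
    (η : Lam m) : IsWeakDT (modelFn m j c) T (formLp hT φ η) (dForm hT j φ η) := by
  intro χ
  set f := modelFn m j c with hf
  set v : Fin (m + 1) → E m := fun i => EuclideanSpace.single i 1 with hv
  have z0 : ∀ Z, Z ∉ tsupport χ → χ Z = 0 := fun Z h => image_eq_zero_of_notMem_tsupport h
  have hχ' : ∀ i, Continuous (fun Z => fderiv ℝ χ Z (v i)) := fun i =>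
    (χ.contDiff.continuous_fderiv (by simp)).clm_apply continuous_const
  have hf' : ∀ i, Continuous (fun Z => fderiv ℝ f Z (v i)) := fun i =>
    ((contDiff_modelFn m j c).continuous_fderiv (by simp)).clm_apply continuous_const
  have hφ := (contDiff_re φ).continuous
  have hL : ∫ Z, χ Z • dForm hT j φ η Z ∂(μ m) =
      ∫ Z, ∑ i, (χ Z * ((lower j i φ).1 Z).re) • extMul i η ∂(μ m) := by
    refine integral_congr_ae ?_
    have h1 := Lp.coeFn_finsetSum Finset.univ fun i => formLp hT (lower j i φ) (extMul i η)
    have h2 := Filter.eventually_all.2 fun i => coeFn_formLp hT (lower j i φ) (extMul i η)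
    filter_upwards [h1, h2] with Z hZ hZ2
    rw [dForm, hZ, Finset.sum_apply, Finset.smul_sum]
    exact Finset.sum_congr rfl fun i _ => by rw [hZ2 i, smul_smul]
  have hR : ∫ Z, wedge m ((χ Z * T) • fderiv ℝ f Z - fderiv ℝ χ Z) (formLp hT φ η Z) ∂(μ m) =
      ∫ Z, ∑ i, ((χ Z * T * fderiv ℝ f Z (v i) - fderiv ℝ χ Z (v i)) * (φ.1 Z).re) •
        extMul i η ∂(μ m) := by
    refine integral_congr_ae ?_
    filter_upwards [coeFn_formLp hT φ η] with Z hZ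
    rw [hZ, map_smul, wedge_eq_sum, Finset.smul_sum]
    refine Finset.sum_congr rfl fun i _ => ?_
    rw [smul_smul, mul_comm]
    simp [hv]
  have i1 : ∀ i, Integrable (fun Z => χ Z * ((lower j i φ).1 Z).re) (μ m) := fun i =>
    integrable_of_test χ (χ.continuous.mul (contDiff_re _).continuous)
      (fun Z h => by simp [z0 Z h]) _
  have i2 : ∀ i, Integrable (fun Z =>
      (χ Z * T * fderiv ℝ f Z (v i) - fderiv ℝ χ Z (v i)) * (φ.1 Z).re) (μ m) := fun i =>
    integrable_of_test χ ((((χ.continuous.mul continuous_const).mul (hf' i)).sub (hχ' i)).mul hφ)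
      (fun Z h => by simp [z0 Z h, fderiv_test_eq_zero χ h]) _
  rw [hL, hR, integral_finsetSum _ fun i _ => (i1 i).smul_const _,
    integral_finsetSum _ fun i _ => (i2 i).smul_const _]
  refine Finset.sum_congr rfl fun i _ => ?_
  rw [integral_smul_const, integral_smul_const]
  congr 1
  have i3 : Integrable (fun Z => χ Z * ((diff i φ).1 Z).re) (μ m) :=
    integrable_of_test χ (χ.continuous.mul (contDiff_re _).continuous)
      (fun Z h => by simp [z0 Z h]) _
  have i4 : Integrable (fun Z => χ Z * T * fderiv ℝ f Z (v i) * (φ.1 Z).re) (μ m) :=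
    integrable_of_test χ (((χ.continuous.mul continuous_const).mul (hf' i)).mul hφ)
      (fun Z h => by simp [z0 Z h]) _
  have i5 : Integrable (fun Z => fderiv ℝ χ Z (v i) * (φ.1 Z).re) (μ m) :=
    integrable_of_test χ ((hχ' i).mul hφ)
      (fun Z h => by simp [fderiv_test_eq_zero χ h]) _
  have e1 : ∀ Z, χ Z * ((lower j i φ).1 Z).re =
      χ Z * ((diff i φ).1 Z).re + χ Z * T * fderiv ℝ f Z (v i) * (φ.1 Z).re := by
    intro Z
    have : ((lower j i φ).1 Z).re = ((diff i φ).1 Z).re + T * ((gradMul j i φ).1 Z).re := by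
      simp [lower]
    rw [this, re_gradMul j c]
    ring
  simp only [e1, sub_mul]
  rw [integral_add i3 i4, integral_sub i4 i5, integral_test_mul_diff]
  ring

/-! ### Cutoff functions -/

/-- This makes `Z_n ∂_n` of the cutoff functions bounded, uniformly in the scale. -/
theorem exists_bound_deriv_smoothTransition :
    ∃ C : ℝ, ∀ t : ℝ, |deriv Real.smoothTransition t * (t + 1)| ≤ C := by
  have hcont : Continuous fun t => deriv Real.smoothTransition t * (t + 1) :=
    ((Real.smoothTransition.contDiff (n := 1)).continuous_deriv le_rfl).mul (by fun_prop)
  have hsupp : HasCompactSupport fun t => deriv Real.smoothTransition t * (t + 1) := by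
    refine HasCompactSupport.intro (isCompact_Icc (a := (0 : ℝ)) (b := 1)) fun t ht => ?_
    have : deriv Real.smoothTransition t = 0 := by
      rw [Set.mem_Icc, not_and_or, not_le, not_le] at ht
      rcases ht with h | h
      · have : Real.smoothTransition =ᶠ[nhds t] fun _ => 0 := by
          filter_upwards [gt_mem_nhds h] with x hx
          exact Real.smoothTransition.zero_of_nonpos hx.le
        rw [this.deriv_eq, deriv_const]
      · have : Real.smoothTransition =ᶠ[nhds t] fun _ => 1 := by
          filter_upwards [lt_mem_nhds h] with x hx
          exact Real.smoothTransition.one_of_one_le hx.le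
        rw [this.deriv_eq, deriv_const]
    rw [this, zero_mul]
  obtain ⟨C, hC⟩ := hcont.bounded_above_of_compact_support hsupp
  exact ⟨C, hC⟩

/-- A fixed bump function, equal to `1` on the unit ball. -/
def bump (m : ℕ) : ContDiffBump (0 : E m) := ⟨1, 2, one_pos, one_lt_two⟩

/-- The cutoff function at scale `r = k + 1`: it vanishes for `Z_n ≤ 1 / r` and for `|Z| ≥ 2 r`,
and equals `1` where `Z_n ≥ 2 / r` and `|Z| ≤ r`. -/
def cutoff {m : ℕ} (k : ℕ) (Z : E m) : ℝ :=
  Real.smoothTransition ((k + 1 : ℝ) * Z (Fin.last m) - 1) * bump m ((k + 1 : ℝ)⁻¹ • Z)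

theorem contDiff_cutoff {m : ℕ} (k : ℕ) : ContDiff ℝ ∞ (cutoff (m := m) k) := by
  have h1 : ContDiff ℝ ∞ fun Z : E m => (k + 1 : ℝ) * Z (Fin.last m) - 1 := by fun_prop
  have h2 : ContDiff ℝ ∞ fun Z : E m => (k + 1 : ℝ)⁻¹ • Z := by fun_prop
  exact (Real.smoothTransition.contDiff.comp h1).mul ((bump m).contDiff.comp h2)

theorem cutoff_nonneg {m : ℕ} (k : ℕ) (Z : E m) : 0 ≤ cutoff k Z :=
  mul_nonneg (Real.smoothTransition.nonneg _) (bump m).nonneg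

theorem cutoff_le_one {m : ℕ} (k : ℕ) (Z : E m) : cutoff k Z ≤ 1 :=
  mul_le_one₀ (Real.smoothTransition.le_one _) (bump m).nonneg (bump m).le_one

theorem hasCompactSupport_cutoff {m : ℕ} (k : ℕ) : HasCompactSupport (cutoff (m := m) k) := by
  have h : HasCompactSupport fun Z : E m => bump m ((k + 1 : ℝ)⁻¹ • Z) :=
    (bump m).hasCompactSupport.comp_homeomorph
      (Homeomorph.smulOfNeZero ((k + 1 : ℝ)⁻¹) (by positivity))
  exact h.mul_left

theorem tsupport_cutoff_subset {m : ℕ} (k : ℕ) :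
    tsupport (cutoff (m := m) k) ⊆ (halfSpace m : Set (E m)) := by
  have hcl : IsClosed {Z : E m | (k + 1 : ℝ)⁻¹ ≤ Z (Fin.last m)} :=
    isClosed_le continuous_const (EuclideanSpace.proj (𝕜 := ℝ) (Fin.last m)).continuous
  refine (closure_minimal (fun Z hZ => ?_) hcl).trans fun Z hZ => ?_
  · rw [Set.mem_ofPred_eq]
    by_contra hlt
    refine hZ ?_
    have hk : (0 : ℝ) < k + 1 := by positivity
    have : (k + 1 : ℝ) * Z (Fin.last m) < 1 := by
      rw [not_le] at hlt
      calc _ < (k + 1 : ℝ) * (k + 1 : ℝ)⁻¹ := mul_lt_mul_of_pos_left hlt hk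
        _ = 1 := mul_inv_cancel₀ hk.ne'
    rw [cutoff, Real.smoothTransition.zero_of_nonpos (by linarith), zero_mul]
  · have h0 : (0 : ℝ) < (k + 1 : ℝ)⁻¹ := by positivity
    exact h0.trans_le hZ

/-- At every point of the open half-space the cutoff functions are eventually locally `1`. -/
theorem eventually_cutoff_eq_one {m : ℕ} {Z : E m} (hZ : 0 < Z (Fin.last m)) :
    ∀ᶠ k : ℕ in Filter.atTop, cutoff k =ᶠ[nhds Z] fun _ => 1 := by
  obtain ⟨N, hN⟩ := exists_nat_gt (max (2 / Z (Fin.last m)) ‖Z‖)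
  filter_upwards [Filter.eventually_ge_atTop N] with k hk
  have hkN : (N : ℝ) ≤ k := by exact_mod_cast hk
  have hk0 : (0 : ℝ) < k + 1 := by positivity
  have h1 : 2 < (k + 1 : ℝ) * Z (Fin.last m) := by
    have := (le_max_left _ _).trans_lt hN
    rw [div_lt_iff₀ hZ] at this
    nlinarith
  have h2 : ‖Z‖ < k + 1 := by
    have := (le_max_right _ _).trans_lt hN
    linarith
  have c1 : Continuous fun Z : E m => (k + 1 : ℝ) * Z (Fin.last m) :=
    continuous_const.mul (EuclideanSpace.proj (𝕜 := ℝ) (Fin.last m)).continuous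
  filter_upwards [c1.continuousAt.eventually (lt_mem_nhds h1),
    continuous_norm.continuousAt.eventually (gt_mem_nhds h2)] with Y hY1 hY2
  rw [cutoff, Real.smoothTransition.one_of_one_le (by linarith), one_mul]
  refine (bump m).one_of_mem_closedBall ?_
  rw [mem_closedBall_zero_iff, norm_smul, norm_inv, Real.norm_of_nonneg hk0.le]
  change (k + 1 : ℝ)⁻¹ * ‖Y‖ ≤ 1
  rw [inv_mul_le_iff₀ hk0]
  linarith

theorem tendsto_cutoff {m : ℕ} {Z : E m} (hZ : 0 < Z (Fin.last m)) :
    Filter.Tendsto (fun k => cutoff k Z) Filter.atTop (nhds 1) :=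
  tendsto_const_nhds.congr' <| (eventually_cutoff_eq_one hZ).mono fun _ h => h.eq_of_nhds.symm

theorem tendsto_fderiv_cutoff {m : ℕ} {Z : E m} (hZ : 0 < Z (Fin.last m)) (v : E m) :
    Filter.Tendsto (fun k => fderiv ℝ (cutoff k) Z v) Filter.atTop (nhds 0) := by
  refine tendsto_const_nhds.congr' <| (eventually_cutoff_eq_one hZ).mono fun _ h => ?_
  simp [h.fderiv_eq]

theorem fderiv_cutoff {m : ℕ} (k : ℕ) (Z v : E m) :
    fderiv ℝ (cutoff k) Z v =
      deriv Real.smoothTransition ((k + 1 : ℝ) * Z (Fin.last m) - 1) *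
        ((k + 1 : ℝ) * v (Fin.last m)) * bump m ((k + 1 : ℝ)⁻¹ • Z) +
      Real.smoothTransition ((k + 1 : ℝ) * Z (Fin.last m) - 1) *
        ((k + 1 : ℝ)⁻¹ * fderiv ℝ (bump m) ((k + 1 : ℝ)⁻¹ • Z) v) := by
  have hp : HasFDerivAt (fun Z : E m => Z (Fin.last m))
      (EuclideanSpace.proj (𝕜 := ℝ) (Fin.last m)) Z :=
    (EuclideanSpace.proj (𝕜 := ℝ) (Fin.last m) : E m →L[ℝ] ℝ).hasFDerivAt
  have h1 := ((Real.smoothTransition.contDiff (n := 1)).differentiable one_ne_zero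
    ((k + 1 : ℝ) * Z (Fin.last m) - 1)).hasDerivAt.comp_hasFDerivAt Z
      ((hp.const_mul (k + 1 : ℝ)).sub_const 1)
  have h2 := (((bump m).contDiff (n := 1)).differentiable one_ne_zero
    ((k + 1 : ℝ)⁻¹ • Z)).hasFDerivAt.comp Z ((hasFDerivAt_id Z).const_smul (k + 1 : ℝ)⁻¹)
  have h3 : fderiv ℝ (cutoff k) Z = _ := (h1.mul h2).fderiv
  rw [h3]
  simp
  ring

theorem exists_bound_fderiv_cutoff (m : ℕ) :
    ∃ C : ℝ, ∀ (k : ℕ) (Z : E m), 0 < Z (Fin.last m) → ∀ i,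
      |fderiv ℝ (cutoff k) Z (EuclideanSpace.single i 1)| ≤
        C * (1 + if i = Fin.last m then (Z (Fin.last m))⁻¹ else 0) := by
  obtain ⟨C₁, hC₁⟩ := exists_bound_deriv_smoothTransition
  obtain ⟨C₂, hC₂⟩ := (((bump m).contDiff (n := 1)).continuous_fderiv
    one_ne_zero).bounded_above_of_compact_support ((bump m).hasCompactSupport.fderiv (𝕜 := ℝ))
  have hC₁0 : 0 ≤ C₁ := (abs_nonneg _).trans (hC₁ 0)
  have hC₂0 : 0 ≤ C₂ := (norm_nonneg _).trans (hC₂ 0)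
  refine ⟨C₁ + C₂, fun k Z hZ i => ?_⟩
  have hk : (0 : ℝ) < k + 1 := by positivity
  have hb : |Real.smoothTransition ((k + 1 : ℝ) * Z (Fin.last m) - 1) *
      ((k + 1 : ℝ)⁻¹ * fderiv ℝ (bump m) ((k + 1 : ℝ)⁻¹ • Z) (EuclideanSpace.single i 1))| ≤ C₂ := by
    have b1 : |Real.smoothTransition ((k + 1 : ℝ) * Z (Fin.last m) - 1)| ≤ 1 := by
      rw [abs_of_nonneg (Real.smoothTransition.nonneg _)]
      exact Real.smoothTransition.le_one _
    have b2 : |(k + 1 : ℝ)⁻¹| ≤ 1 := by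
      rw [abs_of_pos (by positivity)]
      exact inv_le_one_of_one_le₀ (by linarith [(k.cast_nonneg : (0 : ℝ) ≤ k)])
    have b3 : |fderiv ℝ (bump m) ((k + 1 : ℝ)⁻¹ • Z) (EuclideanSpace.single i 1)| ≤ C₂ := by
      have := ((fderiv ℝ (bump m) ((k + 1 : ℝ)⁻¹ • Z)).le_opNorm
        (EuclideanSpace.single i (1 : ℝ))).trans (mul_le_mul_of_nonneg_right (hC₂ _)
          (norm_nonneg _))
      simpa using this
    rw [abs_mul, abs_mul]
    calc _ ≤ 1 * (1 * C₂) := by gcongr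
      _ = C₂ := by ring
  rw [fderiv_cutoff]
  refine (abs_add_le _ _).trans ?_
  by_cases hi : i = Fin.last m
  · rw [if_pos hi]
    have ha : |deriv Real.smoothTransition ((k + 1 : ℝ) * Z (Fin.last m) - 1) *
        ((k + 1 : ℝ) * (EuclideanSpace.single i (1 : ℝ) : E m) (Fin.last m)) *
          bump m ((k + 1 : ℝ)⁻¹ • Z)| ≤ C₁ * (Z (Fin.last m))⁻¹ := by
      have e : deriv Real.smoothTransition ((k + 1 : ℝ) * Z (Fin.last m) - 1) *
          ((k + 1 : ℝ) * (EuclideanSpace.single i (1 : ℝ) : E m) (Fin.last m)) =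
          (deriv Real.smoothTransition ((k + 1 : ℝ) * Z (Fin.last m) - 1) *
            ((k + 1 : ℝ) * Z (Fin.last m) - 1 + 1)) * (Z (Fin.last m))⁻¹ := by
        subst hi
        simp
        field_simp
      rw [e, abs_mul, abs_mul, abs_of_pos (inv_pos.2 hZ), abs_of_nonneg (bump m).nonneg]
      calc _ ≤ C₁ * (Z (Fin.last m))⁻¹ * 1 := by
            gcongr
            · exact (bump m).nonneg
            · exact hC₁ _
            · exact (bump m).le_one
        _ = _ := mul_one _
    have h0 : 0 ≤ C₂ * (Z (Fin.last m))⁻¹ := mul_nonneg hC₂0 (inv_pos.2 hZ).le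
    nlinarith
  · rw [if_neg hi]
    have : (EuclideanSpace.single i (1 : ℝ) : E m) (Fin.last m) = 0 := by
      simp [Ne.symm hi]
    rw [this]
    simp only [mul_zero, zero_mul, abs_zero, zero_add, add_zero, mul_one]
    linarith

theorem tendsto_integral_cutoff_mul {m : ℕ} {g : E m → ℝ} (hg : Integrable g (μ m)) :
    Filter.Tendsto (fun k => ∫ Z, cutoff k Z * g Z ∂(μ m)) Filter.atTop
      (nhds (∫ Z, g Z ∂(μ m))) := by
  refine tendsto_integral_of_dominated_convergence (fun Z => |g Z|)
    (fun k => (contDiff_cutoff k).continuous.aestronglyMeasurable.mul hg.1) hg.abs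
    (fun k => Filter.Eventually.of_forall fun Z => ?_) ?_
  · rw [Real.norm_eq_abs, abs_mul, abs_of_nonneg (cutoff_nonneg k Z)]
    exact mul_le_of_le_one_left (abs_nonneg _) (cutoff_le_one k Z)
  · filter_upwards [ae_pos_last m] with Z hZ
    simpa using (tendsto_cutoff hZ).mul_const (g Z)

theorem tendsto_integral_fderiv_cutoff_mul {m : ℕ} {g : E m → ℝ} (i : Fin (m + 1))
    (hg : Integrable g (μ m))
    (hi : i = Fin.last m → Integrable (fun Z => (Z (Fin.last m))⁻¹ * g Z) (μ m)) :
    Filter.Tendsto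
      (fun k => ∫ Z, fderiv ℝ (cutoff k) Z (EuclideanSpace.single i 1) * g Z ∂(μ m))
      Filter.atTop (nhds 0) := by
  obtain ⟨C, hC⟩ := exists_bound_fderiv_cutoff m
  have hb : Integrable (fun Z : E m => C * (|g Z| +
      if i = Fin.last m then |(Z (Fin.last m))⁻¹ * g Z| else 0)) (μ m) := by
    refine (hg.abs.add ?_).const_mul C
    split_ifs with h
    · exact (hi h).abs
    · exact integrable_zero _ _ _
  have := tendsto_integral_of_dominated_convergence (f := fun _ => (0 : ℝ)) _
    (fun k => (((contDiff_cutoff k).continuous_fderiv (by simp)).clm_apply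
      continuous_const).aestronglyMeasurable.mul hg.1) hb
    (F := fun k Z => fderiv ℝ (cutoff k) Z (EuclideanSpace.single i 1) * g Z)
    (fun k => ?_) ?_
  · simpa using this
  · filter_upwards [ae_pos_last m] with Z hZ
    rw [Real.norm_eq_abs, abs_mul]
    refine (mul_le_mul_of_nonneg_right (hC k Z hZ i) (abs_nonneg _)).trans (le_of_eq ?_)
    split_ifs
    · rw [abs_mul, abs_of_pos (inv_pos.2 hZ)]
      ring
    · ring
  · filter_upwards [ae_pos_last m] with Z hZ
    simpa using (tendsto_fderiv_cutoff hZ _).mul_const (g Z)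

/-! ### The adjoint on test forms -/

/-- The formal adjoint of `d_T` on `φ η`, that is, `∑ i, (-∂_i φ + T ∂_i f φ) ι_i η`. -/
def deltaForm {m : ℕ} {T : ℝ} (hT : 0 < T) (j : ℕ) (φ : testSpace m T) (η : Lam m) : L2Forms m :=
  ∑ i, formLp hT (raise j i φ) (contr i η)

theorem inner_formLp {m : ℕ} {T : ℝ} (hT : 0 < T) (u : L2Forms m) (φ : testSpace m T)
    (η : Lam m) : ⟪u, formLp hT φ η⟫_ℝ = ∫ Z, (φ.1 Z).re * ⟪η, u Z⟫_ℝ ∂(μ m) := by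
  rw [L2.inner_def]
  refine integral_congr_ae ?_
  filter_upwards [coeFn_formLp hT φ η] with Z hZ
  rw [hZ, inner_smul_right, real_inner_comm]

theorem memLp_inner {m : ℕ} (η : Lam m) (u : L2Forms m) :
    MemLp (fun Z => ⟪η, u Z⟫_ℝ) 2 (μ m) :=
  (Lp.memLp u).const_inner η

theorem integrable_re_mul_inner {m : ℕ} {T : ℝ} (hT : 0 < T) (u : L2Forms m) (φ : testSpace m T)
    (η : Lam m) : Integrable (fun Z => (φ.1 Z).re * ⟪η, u Z⟫_ℝ) (μ m) :=
  (memLp_of_mem_testSpace hT φ.2).re.integrable_mul (memLp_inner η u)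

theorem inner_wedge {m : ℕ} (ξ : E m →L[ℝ] ℝ) (η ζ : Lam m) :
    ⟪η, wedge m ξ ζ⟫_ℝ = ∑ i, ξ (EuclideanSpace.single i 1) * ⟪contr i η, ζ⟫_ℝ := by
  rw [wedge_eq_sum, inner_sum]
  refine Finset.sum_congr rfl fun i _ => ?_
  rw [inner_smul_right, contr, LinearMap.adjoint_inner_left]

/-- The weak identity defining `d_T w = u` extends to test forms `φ η` that need not have compact
support, if the normal component of `φ η` vanishes on the boundary. -/
theorem IsWeakDT.inner_formLp_eq {m : ℕ} {T : ℝ} (hT : 0 < T) {j : ℕ} {c : ℝ} {w u : L2Forms m}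
    (h : IsWeakDT (modelFn m j c) T w u) {φ : testSpace m T} {η : Lam m}
    (hbc : φ ∈ bdrySpace m T ∨ contr (Fin.last m) η = 0) :
    ⟪u, formLp hT φ η⟫_ℝ = ⟪w, deltaForm hT j φ η⟫_ℝ := by
  set v : Fin (m + 1) → E m := fun i => EuclideanSpace.single i 1 with hv
  have hφ := contDiff_re φ
  have hχ : ∀ k, ContDiff ℝ ∞ fun Z : E m => cutoff k Z * (φ.1 Z).re := fun k =>
    (contDiff_cutoff k).mul hφ
  let χ : ℕ → 𝓓(halfSpace m, ℝ) := fun k =>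
    ⟨fun Z => cutoff k Z * (φ.1 Z).re, hχ k, (hasCompactSupport_cutoff k).mul_right,
      (tsupport_mul_subset_left (f := cutoff k)).trans (tsupport_cutoff_subset k)⟩
  have hχv : ∀ k Z, χ k Z = cutoff k Z * (φ.1 Z).re := fun _ _ => rfl
  have hdχ : ∀ k Z i, fderiv ℝ (χ k) Z (v i) =
      fderiv ℝ (cutoff k) Z (v i) * (φ.1 Z).re + cutoff k Z * ((diff i φ).1 Z).re := by
    intro k Z i
    have h1 : fderiv ℝ (χ k) Z = fderiv ℝ (fun Z => cutoff k Z * (φ.1 Z).re) Z := rfl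
    rw [h1, fderiv_fun_mul ((contDiff_cutoff k).differentiable (by simp) Z)
      (hφ.differentiable (by simp) Z), ← fderiv_re]
    simp [hv]
    ring
  have hω : ∀ i, MemLp (fun Z => ⟪contr i η, w Z⟫_ℝ) 2 (μ m) := fun i => memLp_inner _ w
  have i1 : ∀ k i, Integrable (fun Z => cutoff k Z *
      (((raise j i φ).1 Z).re * ⟪contr i η, w Z⟫_ℝ)) (μ m) := fun k i => by
    refine (integrable_re_mul_inner hT w (raise j i φ) (contr i η)).mono
      ((contDiff_cutoff k).continuous.aestronglyMeasurable.mul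
        (integrable_re_mul_inner hT w (raise j i φ) (contr i η)).1)
      (Filter.Eventually.of_forall fun Z => ?_)
    rw [norm_mul, Real.norm_of_nonneg (cutoff_nonneg k Z)]
    exact mul_le_of_le_one_left (norm_nonneg _) (cutoff_le_one k Z)
  have i2 : ∀ k i, Integrable (fun Z => fderiv ℝ (cutoff k) Z (v i) *
      ((φ.1 Z).re * ⟪contr i η, w Z⟫_ℝ)) (μ m) := fun k i => by
    have hc : Continuous fun Z => fderiv ℝ (cutoff k) Z (v i) * (φ.1 Z).re :=
      (((contDiff_cutoff k).continuous_fderiv (by simp)).clm_apply continuous_const).mul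
        hφ.continuous
    have hs : HasCompactSupport fun Z => fderiv ℝ (cutoff k) Z (v i) * (φ.1 Z).re :=
      ((hasCompactSupport_cutoff k).fderiv_apply (𝕜 := ℝ) (v i)).mul_right
    simp only [← mul_assoc]
    exact (hc.memLp_of_hasCompactSupport (p := 2) hs).integrable_mul (hω i)
  -- the weak identity tested against the cut off form
  have hk : ∀ k, ∫ Z, cutoff k Z * ((φ.1 Z).re * ⟪η, u Z⟫_ℝ) ∂(μ m) =
      ∑ i, (∫ Z, cutoff k Z * (((raise j i φ).1 Z).re * ⟪contr i η, w Z⟫_ℝ) ∂(μ m) -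
        ∫ Z, fderiv ℝ (cutoff k) Z (v i) * ((φ.1 Z).re * ⟪contr i η, w Z⟫_ℝ) ∂(μ m)) := by
    intro k
    have h1 := congrArg (fun ζ => innerSL ℝ η ζ) (h (χ k))
    simp only [innerSL_apply_apply] at h1
    rw [← integral_inner (integrable_test_smul (χ k) u),
      ← integral_inner (integrable_wedge (contDiff_modelFn m j c) T (χ k) w)] at h1
    have e1 : ∀ Z, ⟪η, χ k Z • u Z⟫_ℝ = cutoff k Z * ((φ.1 Z).re * ⟪η, u Z⟫_ℝ) := fun Z => by
      rw [inner_smul_right, hχv, mul_assoc]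
    have e2 : ∀ Z, ⟪η, wedge m ((χ k Z * T) • fderiv ℝ (modelFn m j c) Z - fderiv ℝ (χ k) Z)
        (w Z)⟫_ℝ = ∑ i, (cutoff k Z * (((raise j i φ).1 Z).re * ⟪contr i η, w Z⟫_ℝ) -
          fderiv ℝ (cutoff k) Z (v i) * ((φ.1 Z).re * ⟪contr i η, w Z⟫_ℝ)) := fun Z => by
      rw [inner_wedge]
      refine Finset.sum_congr rfl fun i _ => ?_
      have hr : ((raise j i φ).1 Z).re =
          -((diff i φ).1 Z).re + T * ((gradMul j i φ).1 Z).re := by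
        simp [raise]
      have hd := hdχ k Z i
      rw [sub_apply, smul_apply, hd, hχv, hr,
        re_gradMul j c, smul_eq_mul]
      ring
    simp only [e1, e2] at h1
    refine h1.trans ((integral_finsetSum _ fun i _ => (i1 k i).sub (i2 k i)).trans ?_)
    exact Finset.sum_congr rfl fun i _ => integral_sub (i1 k i) (i2 k i)
  have hL := tendsto_integral_cutoff_mul (integrable_re_mul_inner hT u φ η)
  have hR : Filter.Tendsto (fun k => ∑ i,
      (∫ Z, cutoff k Z * (((raise j i φ).1 Z).re * ⟪contr i η, w Z⟫_ℝ) ∂(μ m) -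
        ∫ Z, fderiv ℝ (cutoff k) Z (v i) * ((φ.1 Z).re * ⟪contr i η, w Z⟫_ℝ) ∂(μ m)))
      Filter.atTop
      (nhds (∑ i, (∫ Z, ((raise j i φ).1 Z).re * ⟪contr i η, w Z⟫_ℝ ∂(μ m) - 0))) := by
    refine tendsto_finsetSum _ fun i _ => Filter.Tendsto.sub
      (tendsto_integral_cutoff_mul (integrable_re_mul_inner hT w _ _))
      (tendsto_integral_fderiv_cutoff_mul i (integrable_re_mul_inner hT w _ _) ?_)
    rintro rfl
    -- in the normal direction `∂_n` of the cutoff is only `O(1 / Z_n)`, which is where the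
    -- boundary condition enters
    rcases hbc with hbc | hbc
    · have := MemLp.re hbc
      refine (this.integrable_mul (hω (Fin.last m))).congr (Filter.Eventually.of_forall fun Z => ?_)
      simp [mul_assoc]
    · simp [hbc]
  rw [inner_formLp, tendsto_nhds_unique hL (hR.congr fun k => (hk k).symm), deltaForm, inner_sum]
  exact Finset.sum_congr rfl fun i _ => by rw [inner_formLp, sub_zero]

/-! ### Graphs of the operators -/

theorem mem_graph_iff_exists {H : Type*} [AddCommGroup H] [Module ℝ H] {A : H →ₗ.[ℝ] H}
    {v y : H} : (v, y) ∈ A.graph ↔ ∃ h : v ∈ A.domain, A ⟨v, h⟩ = y := by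
  rw [LinearPMap.mem_graph_iff]
  constructor
  · rintro ⟨⟨x, hx⟩, rfl, h⟩
    exact ⟨hx, h⟩
  · rintro ⟨h, h'⟩
    exact ⟨⟨v, h⟩, rfl, h'⟩

theorem sum_mem_graph {H ι : Type*} [AddCommGroup H] [Module ℝ H] {A : H →ₗ.[ℝ] H}
    {s : Finset ι} {v y : ι → H} (h : ∀ i ∈ s, (v i, y i) ∈ A.graph) :
    (∑ i ∈ s, v i, ∑ i ∈ s, y i) ∈ A.graph := by
  have e : (∑ i ∈ s, v i, ∑ i ∈ s, y i) = ∑ i ∈ s, (v i, y i) :=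
    Prod.ext (by simp [Prod.fst_sum]) (by simp [Prod.snd_sum])
  rw [e]
  exact Submodule.sum_mem _ h

theorem mem_graph_comp {H : Type*} [AddCommGroup H] [Module ℝ H] {B A : H →ₗ.[ℝ] H} {v q : H} :
    (v, q) ∈ (comp B A).graph ↔ ∃ p, (v, p) ∈ A.graph ∧ (p, q) ∈ B.graph := by
  constructor
  · intro h
    obtain ⟨⟨⟨x, hx, rfl⟩, hA⟩, rfl⟩ := mem_graph_iff_exists.1 h
    exact ⟨A x, LinearPMap.mem_graph A x, LinearPMap.mem_graph B ⟨A x, hx⟩⟩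
  · rintro ⟨p, hp, hq⟩
    obtain ⟨hv, rfl⟩ := mem_graph_iff_exists.1 hp
    obtain ⟨hAv, rfl⟩ := mem_graph_iff_exists.1 hq
    exact mem_graph_iff_exists.2 ⟨⟨⟨⟨v, hv⟩, hAv, rfl⟩, hv⟩, rfl⟩

theorem mem_graph_add {H : Type*} [AddCommGroup H] [Module ℝ H] {B A : H →ₗ.[ℝ] H} {v y : H} :
    (v, y) ∈ (A + B).graph ↔ ∃ a b, (v, a) ∈ A.graph ∧ (v, b) ∈ B.graph ∧ y = a + b := by
  constructor
  · intro h
    obtain ⟨hv, rfl⟩ := mem_graph_iff_exists.1 h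
    exact ⟨A ⟨v, hv.1⟩, B ⟨v, hv.2⟩, LinearPMap.mem_graph A ⟨v, hv.1⟩,
      LinearPMap.mem_graph B ⟨v, hv.2⟩, rfl⟩
  · rintro ⟨a, b, ha, hb, rfl⟩
    obtain ⟨hA, rfl⟩ := mem_graph_iff_exists.1 ha
    obtain ⟨hB, rfl⟩ := mem_graph_iff_exists.1 hb
    exact mem_graph_iff_exists.2 ⟨⟨hA, hB⟩, rfl⟩

theorem mem_graph_gaffney {H : Type*} [NormedAddCommGroup H] [InnerProductSpace ℝ H]
    [CompleteSpace H] {A : H →ₗ.[ℝ] H} {v y : H} :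
    (v, y) ∈ (gaffney A).graph ↔ ∃ p q r s, (v, r) ∈ A.adjoint.graph ∧ (r, s) ∈ A.graph ∧
      (v, p) ∈ A.graph ∧ (p, q) ∈ A.adjoint.graph ∧ y = s + q := by
  rw [gaffney, mem_graph_add]
  simp only [mem_graph_comp]
  constructor
  · rintro ⟨s, q, ⟨r, h1, h2⟩, ⟨p, h3, h4⟩, h⟩
    exact ⟨p, q, r, s, h1, h2, h3, h4, h⟩
  · rintro ⟨p, q, r, s, h1, h2, h3, h4, h⟩
    exact ⟨s, q, ⟨r, h1, h2⟩, ⟨p, h3, h4⟩, h⟩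

theorem inner_of_mem_graph_adjoint {H : Type*} [NormedAddCommGroup H] [InnerProductSpace ℝ H]
    [CompleteSpace H] {A : H →ₗ.[ℝ] H} (hA : Dense (A.domain : Set H)) {v r x y : H}
    (h : (v, r) ∈ A.adjoint.graph) (hxy : (x, y) ∈ A.graph) : ⟪r, x⟫_ℝ = ⟪v, y⟫_ℝ := by
  obtain ⟨a, rfl, rfl⟩ := (LinearPMap.mem_graph_iff _).1 h
  obtain ⟨b, rfl, rfl⟩ := (LinearPMap.mem_graph_iff _).1 hxy
  exact LinearPMap.adjoint_isFormalAdjoint hA a b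

theorem mem_graph_adjoint_of_inner {H : Type*} [NormedAddCommGroup H] [InnerProductSpace ℝ H]
    [CompleteSpace H] {A : H →ₗ.[ℝ] H} (hA : Dense (A.domain : Set H)) {v r : H}
    (h : ∀ x y, (x, y) ∈ A.graph → ⟪r, x⟫_ℝ = ⟪v, y⟫_ℝ) : (v, r) ∈ A.adjoint.graph := by
  have hv : v ∈ A.adjoint.domain := LinearPMap.mem_adjoint_domain_of_exists _
    ⟨r, fun x => h _ _ (LinearPMap.mem_graph _ _)⟩
  refine (LinearPMap.mem_graph_iff _).2 ⟨⟨v, hv⟩, rfl, ?_⟩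
  exact LinearPMap.adjoint_apply_eq hA _ fun x => h _ _ (LinearPMap.mem_graph _ _)

/-- The operator `A A^* + A^* A` is symmetric. -/
theorem inner_gaffney_symm {H : Type*} [NormedAddCommGroup H] [InnerProductSpace ℝ H]
    [CompleteSpace H] {A : H →ₗ.[ℝ] H} (hA : Dense (A.domain : Set H)) {v y v' y' : H}
    (h : (v, y) ∈ (gaffney A).graph) (h' : (v', y') ∈ (gaffney A).graph) :
    ⟪y, v'⟫_ℝ = ⟪v, y'⟫_ℝ := by
  obtain ⟨p, q, r, s, h1, h2, h3, h4, rfl⟩ := mem_graph_gaffney.1 h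
  obtain ⟨p', q', r', s', h1', h2', h3', h4', rfl⟩ := mem_graph_gaffney.1 h'
  have e1 := inner_of_mem_graph_adjoint hA h1' h2
  have e2 := inner_of_mem_graph_adjoint hA h1 h2'
  have e3 := inner_of_mem_graph_adjoint hA h4 h3'
  have e4 := inner_of_mem_graph_adjoint hA h4' h3
  rw [inner_add_left, inner_add_right, e3, ← e2, real_inner_comm v' s, ← e1, real_inner_comm q' v,
    e4, real_inner_comm p' p, real_inner_comm r r']

theorem mem_kernel_iff {H : Type*} [NormedAddCommGroup H] [InnerProductSpace ℝ H]
    {A : H →ₗ.[ℝ] H} {w : H} : w ∈ kernel A ↔ (w, 0) ∈ A.graph := by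
  rw [kernel, Submodule.mem_map, LinearPMap.mem_graph_iff]
  constructor
  · rintro ⟨x, hx, rfl⟩
    exact ⟨x, rfl, hx⟩
  · rintro ⟨x, rfl, hx⟩
    exact ⟨x, hx, rfl⟩

theorem mem_graph_dT {m : ℕ} {f : E m → ℝ} (hf : ContDiff ℝ ∞ f) {T : ℝ} {w u : L2Forms m} :
    (w, u) ∈ (dT f hf T).graph ↔ IsWeakDT f T w u := by
  constructor
  · intro h
    obtain ⟨x, rfl, rfl⟩ := (LinearPMap.mem_graph_iff _).1 h
    exact x.2.choose_spec
  · intro h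
    let x : (dT f hf T).domain := ⟨w, u, h⟩
    exact (LinearPMap.mem_graph_iff _).2 ⟨x, rfl, x.2.choose_spec.unique h⟩

/-! ### The Witten Laplacian on test forms -/

/-- The operator `d_T` of the model function. -/
abbrev modelDT (m j : ℕ) (c T : ℝ) : L2Forms m →ₗ.[ℝ] L2Forms m :=
  dT (modelFn m j c) (contDiff_modelFn m j c) T

theorem dForm_mem_graph {m : ℕ} {T : ℝ} (hT : 0 < T) (j : ℕ) (c : ℝ) (φ : testSpace m T)
    (η : Lam m) : (formLp hT φ η, dForm hT j φ η) ∈ (modelDT m j c T).graph :=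
  (mem_graph_dT _).2 (isWeakDT_formLp hT j c φ η)

theorem deltaForm_mem_graph {m : ℕ} {T : ℝ} (hT : 0 < T) {j : ℕ} {c : ℝ}
    (hd : Dense ((modelDT m j c T).domain : Set (L2Forms m))) {φ : testSpace m T} {η : Lam m}
    (hbc : φ ∈ bdrySpace m T ∨ contr (Fin.last m) η = 0) :
    (formLp hT φ η, deltaForm hT j φ η) ∈ (modelDT m j c T).adjoint.graph := by
  refine mem_graph_adjoint_of_inner hd fun x y hxy => ?_
  rw [real_inner_comm x, real_inner_comm y]
  exact (((mem_graph_dT _).1 hxy).inner_formLp_eq hT hbc).symm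

/-- The second derivative `∂_i² f` of the model function. -/
def hess {m : ℕ} (j : ℕ) (i : Fin (m + 1)) : ℝ := if i = Fin.last m then 0 else hessSign j i

theorem diff_gradMul {m : ℕ} {T : ℝ} (j : ℕ) (i k : Fin (m + 1)) (φ : testSpace m T) :
    diff i (gradMul j k φ) = gradMul j k (diff i φ) +
      if i = k then (hess j i : ℂ) • φ else 0 := by
  by_cases hk : k = Fin.last m
  · subst hk
    by_cases hi : i = Fin.last m <;> simp [gradMul, hess, hi]
  · by_cases hi : i = k
    · subst hi
      simp only [gradMul, hess, hk, if_false, if_true, LinearMap.smul_apply, map_smul,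
        diff_coordMul, smul_add]
    · simp [gradMul, hk, diff_coordMul, hi]

theorem gradMul_comm {m : ℕ} {T : ℝ} (j : ℕ) (i k : Fin (m + 1)) (φ : testSpace m T) :
    gradMul j i (gradMul j k φ) = gradMul j k (gradMul j i φ) := by
  by_cases hi : i = Fin.last m <;> by_cases hk : k = Fin.last m <;>
    simp only [gradMul, hi, hk, if_true, if_false, LinearMap.id_apply, LinearMap.smul_apply]
  refine Subtype.ext (funext fun Z => ?_)
  simp [coordMul]
  ring

/-- The commutator of `∂_i + T ∂_i f` and `-∂_k + T ∂_k f` is `2 T ∂_i ∂_k f`. -/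
theorem lower_raise {m : ℕ} {T : ℝ} (j : ℕ) (i k : Fin (m + 1)) (φ : testSpace m T) :
    lower j i (raise j k φ) = raise j k (lower j i φ) +
      if i = k then ((2 * T * hess j i : ℝ) : ℂ) • φ else 0 := by
  simp only [lower, raise, LinearMap.add_apply, LinearMap.neg_apply, LinearMap.smul_apply, map_add,
    map_neg, map_smul, diff_gradMul, diff_comm i k, gradMul_comm j i k]
  by_cases h : i = k
  · subst h
    simp only [if_true]
    push_cast
    module
  · simp only [if_neg h, if_neg (Ne.symm h)]
    module

/-- The scalar operator by which the Witten Laplacian acts on forms `φ e^I`. -/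
def ham {m : ℕ} {T : ℝ} (j : ℕ) (I : Finset (Fin (m + 1))) : testSpace m T →ₗ[ℂ] testSpace m T :=
  ∑ i, (raise j i ∘ₗ lower j i +
    ((2 * T * if i ∈ I then hess j i else 0 : ℝ) : ℂ) • LinearMap.id)

theorem sum_dForm_add_sum_deltaForm {m : ℕ} {T : ℝ} (hT : 0 < T) (j : ℕ) (φ : testSpace m T)
    (I : Finset (Fin (m + 1))) :
    ∑ k, dForm hT j (raise j k φ) (contr k (basisVec I)) +
      ∑ i, deltaForm hT j (lower j i φ) (extMul i (basisVec I)) =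
      formLp hT (ham j I φ) (basisVec I) := by
  have hs : ∀ (r : ℝ) (ψ : testSpace m T) (η : Lam m),
      formLp hT ((r : ℂ) • ψ) η = r • formLp hT ψ η := by
    intro r ψ η
    rw [← LinearMap.smul_apply, ← map_smul]
    rfl
  have e1 : ∀ i k, formLp hT (lower j i (raise j k φ)) (extMul i (contr k (basisVec I))) =
      formLp hT (raise j k (lower j i φ)) (extMul i (contr k (basisVec I))) +
        if i = k then (2 * T * hess j i) • formLp hT φ (extMul i (contr i (basisVec I))) else 0 := by
    intro i k
    rw [lower_raise, map_add, LinearMap.add_apply]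
    congr 1
    split_ifs with h
    · subst h
      rw [hs]
    · simp
  have e2 : ∀ i k, formLp hT (raise j k (lower j i φ)) (extMul i (contr k (basisVec I))) +
      formLp hT (raise j k (lower j i φ)) (contr k (extMul i (basisVec I))) =
        if i = k then formLp hT (raise j i (lower j i φ)) (basisVec I) else 0 := by
    intro i k
    rw [← map_add, add_comm (extMul i _), contr_extMul_add]
    by_cases h : i = k
    · subst h; simp
    · simp [h, Ne.symm h]
  simp only [dForm, deltaForm]
  rw [Finset.sum_comm, ← Finset.sum_add_distrib]
  simp only [← Finset.sum_add_distrib]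
  have e3 : ∀ i k, formLp hT (lower j i (raise j k φ)) (extMul i (contr k (basisVec I))) +
      formLp hT (raise j k (lower j i φ)) (contr k (extMul i (basisVec I))) =
      if i = k then formLp hT (raise j i (lower j i φ)) (basisVec I) +
        (2 * T * hess j i) • formLp hT φ (extMul i (contr i (basisVec I))) else 0 := by
    intro i k
    rw [e1, add_right_comm, e2]
    split_ifs <;> simp
  simp only [e3, Finset.sum_ite_eq, Finset.mem_univ, if_true]
  rw [ham, LinearMap.sum_apply, map_sum, LinearMap.sum_apply]
  refine Finset.sum_congr rfl fun i _ => ?_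
  rw [LinearMap.add_apply, map_add, LinearMap.add_apply, LinearMap.smul_apply, hs,
    extMul_contr_basisVec]
  split_ifs <;> simp

/-- The boundary condition on `u` for `u e^I` to be in the domain of the Witten Laplacian: it is a
Dirichlet condition if `n ∈ I`, and the condition `(∂_n + T) u = 0` if `n ∉ I`. -/
def BdryCond {m : ℕ} {T : ℝ} (j : ℕ) (I : Finset (Fin (m + 1))) (u : testSpace m T) : Prop :=
  if Fin.last m ∈ I then
    u ∈ bdrySpace m T ∧ ∀ i, i ≠ Fin.last m → lower j i u ∈ bdrySpace m T
  else lower j (Fin.last m) u ∈ bdrySpace m T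

theorem formLp_mem_graph_wittenLaplacian {m : ℕ} {T : ℝ} (hT : 0 < T) {j : ℕ} {c : ℝ}
    (hd : Dense ((modelDT m j c T).domain : Set (L2Forms m))) {u : testSpace m T}
    {I : Finset (Fin (m + 1))} (hu : BdryCond j I u) :
    (formLp hT u (basisVec I), formLp hT (ham j I u) (basisVec I)) ∈
      (wittenLaplacian m j c T).graph := by
  refine mem_graph_gaffney.2 ⟨dForm hT j u (basisVec I),
    ∑ i, deltaForm hT j (lower j i u) (extMul i (basisVec I)),
    deltaForm hT j u (basisVec I), ∑ k, dForm hT j (raise j k u) (contr k (basisVec I)),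
    deltaForm_mem_graph hT hd ?_, ?_, dForm_mem_graph hT j c u _, ?_,
    (sum_dForm_add_sum_deltaForm hT j u I).symm⟩
  · by_cases hI : Fin.last m ∈ I
    · rw [BdryCond, if_pos hI] at hu
      exact Or.inl hu.1
    · exact Or.inr (contr_basisVec_of_notMem hI)
  · exact sum_mem_graph fun k _ => dForm_mem_graph hT j c (raise j k u) (contr k (basisVec I))
  · exact sum_mem_graph fun i _ =>
      deltaForm_mem_graph (φ := lower j i u) (η := extMul i (basisVec I)) hT hd (by
        by_cases hI : Fin.last m ∈ I
        · rw [BdryCond, if_pos hI] at hu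
          by_cases hi : i = Fin.last m
          · right
            rw [hi, extMul_basisVec_of_mem hI, map_zero]
          · exact Or.inl (hu.2 i hi)
        · rw [BdryCond, if_neg hI] at hu
          by_cases hi : i = Fin.last m
          · left
            rwa [hi]
          · right
            have := contr_extMul_add (Fin.last m) i (basisVec I)
            rwa [contr_basisVec_of_notMem hI, map_zero, add_zero, if_neg (Ne.symm hi)] at this)

/-! ### The Witten Laplacian on polynomials times exponentials -/

open MvPolynomial in
/-- The polynomial `∂_i f`, where `f` is the model function. -/
def gradFac {m : ℕ} (j : ℕ) (i : Fin (m + 1)) : MvPolynomial (Fin (m + 1)) ℂ :=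
  if i = Fin.last m then 1 else C (hessSign j i : ℂ) * X i

theorem gradMul_polyTest {m : ℕ} (T : ℝ) (j : ℕ) (i : Fin (m + 1))
    (P : MvPolynomial (Fin (m + 1)) ℂ) {s : ℂ} (hs : 0 < s.re) :
    gradMul j i (polyTest T P hs) = polyTest T (gradFac j i * P) hs := by
  rw [gradMul, gradFac]
  split_ifs
  · simp
  · rw [LinearMap.smul_apply, coordMul_polyTest, mul_assoc, polyTest_C_mul]

open MvPolynomial in
theorem lower_polyTest {m : ℕ} (T : ℝ) (j : ℕ) (i : Fin (m + 1))
    (P : MvPolynomial (Fin (m + 1)) ℂ) {s : ℂ} (hs : 0 < s.re) :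
    lower j i (polyTest T P hs) =
      polyTest T (gradPoly T i P s + C (T : ℂ) * (gradFac j i * P)) hs := by
  rw [polyTest_add, polyTest_C_mul, ← gradMul_polyTest, ← diff_polyTest]
  rfl

open MvPolynomial in
theorem raise_polyTest {m : ℕ} (T : ℝ) (j : ℕ) (i : Fin (m + 1))
    (P : MvPolynomial (Fin (m + 1)) ℂ) {s : ℂ} (hs : 0 < s.re) :
    raise j i (polyTest T P hs) =
      polyTest T (C (-1) * gradPoly T i P s + C (T : ℂ) * (gradFac j i * P)) hs := by
  rw [polyTest_add, polyTest_C_mul, polyTest_C_mul, ← gradMul_polyTest, ← diff_polyTest, raise,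
    LinearMap.add_apply, LinearMap.neg_apply, LinearMap.smul_apply]
  module

open MvPolynomial in
theorem raise_lower_polyTest {m : ℕ} (T : ℝ) (j : ℕ) {i : Fin (m + 1)} (hi : i ≠ Fin.last m)
    (P : MvPolynomial (Fin (m + 1)) ℂ) {s : ℂ} (hs : 0 < s.re) :
    raise j i (lower j i (polyTest T P hs)) =
      polyTest T (C (-1) * pderiv i (pderiv i P) + C (2 * T : ℂ) * (X i * pderiv i P) +
        C (T * (1 - hessSign j i) : ℂ) * P) hs := by
  rw [lower_polyTest, raise_polyTest]
  congr 1
  have hsq : (C (hessSign j i : ℂ) * C (hessSign j i : ℂ) : MvPolynomial (Fin (m + 1)) ℂ) = 1 := by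
    rw [← C_mul, hessSign]
    split_ifs <;> simp
  simp only [gradPoly, gradFac, if_neg hi, map_add, map_sub, pderiv_mul, pderiv_C, pderiv_X_self,
    C_mul, map_one, zero_mul, zero_add, map_neg]
  have h2 : (C 2 : MvPolynomial (Fin (m + 1)) ℂ) = 2 := map_ofNat C 2
  rw [h2]
  linear_combination (C (T : ℂ) ^ 2 * X i ^ 2 * P) * hsq

open MvPolynomial in
theorem lower_last_polyTest {m : ℕ} (T : ℝ) (j : ℕ) {P : MvPolynomial (Fin (m + 1)) ℂ}
    (hP : pderiv (Fin.last m) P = 0) {s : ℂ} (hs : 0 < s.re) :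
    lower j (Fin.last m) (polyTest T P hs) = ((T : ℂ) - s) • polyTest T P hs := by
  rw [lower_polyTest, ← polyTest_C_mul]
  congr 1
  simp only [gradPoly, gradFac, if_true, hP, C_sub]
  ring

open MvPolynomial in
theorem raise_last_polyTest {m : ℕ} (T : ℝ) (j : ℕ) {P : MvPolynomial (Fin (m + 1)) ℂ}
    (hP : pderiv (Fin.last m) P = 0) {s : ℂ} (hs : 0 < s.re) :
    raise j (Fin.last m) (polyTest T P hs) = ((T : ℂ) + s) • polyTest T P hs := by
  rw [raise_polyTest, ← polyTest_C_mul]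
  congr 1
  simp only [gradPoly, gradFac, if_true, hP, C_add, map_neg, map_one]
  ring

open MvPolynomial in
/-- The linear form `a · Z'`, as a polynomial. -/
def linPoly {m : ℕ} (a : Fin m → ℝ) : MvPolynomial (Fin (m + 1)) ℂ :=
  ∑ i, C (a i : ℂ) * X i.castSucc

open MvPolynomial in
theorem pderiv_linPoly {m : ℕ} (a : Fin m → ℝ) (i : Fin m) :
    pderiv i.castSucc (linPoly a) = C (a i : ℂ) := by
  rw [linPoly, map_sum]
  simp [pderiv_X, Pi.single_apply, Fin.castSucc_inj]

open MvPolynomial in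
theorem pderiv_last_linPoly {m : ℕ} (a : Fin m → ℝ) :
    pderiv (Fin.last m) (linPoly a) = 0 := by
  rw [linPoly, map_sum]
  simp [pderiv_X, (Fin.castSucc_lt_last _).ne]

open MvPolynomial in
theorem pderiv_last_linPoly_pow {m : ℕ} (a : Fin m → ℝ) (l : ℕ) :
    pderiv (Fin.last m) (linPoly a ^ l) = 0 := by
  rw [pderiv_pow, pderiv_last_linPoly, mul_zero]

/-- The number of tangential directions in which `I` differs from the set of negative directions;
the ground state energy of the tangential part of the Witten Laplacian on `e^I` is
`2 T * excess j I`. -/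
def excess {m : ℕ} (j : ℕ) (I : Finset (Fin (m + 1))) : ℕ :=
  (Finset.univ.filter fun i : Fin m => ¬(i.castSucc ∈ I ↔ i.val < j)).card

open MvPolynomial in
theorem ham_polyTest {m : ℕ} (T : ℝ) (j : ℕ) (I : Finset (Fin (m + 1))) (a : Fin m → ℝ) (l : ℕ)
    {s : ℂ} (hs : 0 < s.re) :
    ham j I (polyTest T (linPoly a ^ l) hs) =
      (2 * T * (l + excess j I) + T ^ 2 - s ^ 2 : ℂ) • polyTest T (linPoly a ^ l) hs -
        (l * (l - 1 : ℕ) * ∑ i, (a i : ℂ) ^ 2 : ℂ) • polyTest T (linPoly a ^ (l - 2)) hs := by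
  rw [ham, LinearMap.sum_apply, Fin.sum_univ_castSucc]
  have hlast : (raise j (Fin.last m) ∘ₗ lower j (Fin.last m) + ((2 * T *
      if Fin.last m ∈ I then hess j (Fin.last m) else 0 : ℝ) : ℂ) • LinearMap.id :
        testSpace m T →ₗ[ℂ] testSpace m T) (polyTest T (linPoly a ^ l) hs) =
      ((T : ℂ) ^ 2 - s ^ 2) • polyTest T (linPoly a ^ l) hs := by
    have h0 : (if Fin.last m ∈ I then hess j (Fin.last m) else 0) = 0 := by simp [hess]
    rw [h0, LinearMap.add_apply, LinearMap.comp_apply,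
      lower_last_polyTest T j (pderiv_last_linPoly_pow a l), map_smul,
      raise_last_polyTest T j (pderiv_last_linPoly_pow a l), smul_smul]
    simp only [mul_zero, Complex.ofReal_zero, zero_smul, LinearMap.zero_apply, add_zero]
    congr 1
    ring
  have htan : ∀ i : Fin m, (raise j i.castSucc ∘ₗ lower j i.castSucc + ((2 * T *
      if i.castSucc ∈ I then hess j i.castSucc else 0 : ℝ) : ℂ) • LinearMap.id :
        testSpace m T →ₗ[ℂ] testSpace m T) (polyTest T (linPoly a ^ l) hs) =
      -((l * (l - 1 : ℕ) * (a i : ℂ) ^ 2 : ℂ) • polyTest T (linPoly a ^ (l - 2)) hs) +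
      (2 * T : ℂ) • polyTest T (C (l * a i : ℂ) * X i.castSucc * linPoly a ^ (l - 1)) hs +
      (2 * T * if ¬(i.castSucc ∈ I ↔ i.val < j) then 1 else 0 : ℂ) •
        polyTest T (linPoly a ^ l) hs := by
    intro i
    have hi := (Fin.castSucc_lt_last i).ne
    have e1 : pderiv i.castSucc (linPoly a ^ l) = C (l * a i : ℂ) * linPoly a ^ (l - 1) := by
      rw [pderiv_pow, pderiv_linPoly, C_mul]
      simp
      ring
    have e2 : pderiv i.castSucc (pderiv i.castSucc (linPoly a ^ l)) =
        C (l * (l - 1 : ℕ) * (a i : ℂ) ^ 2 : ℂ) * linPoly a ^ (l - 2) := by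
      rw [e1, pderiv_C_mul, pderiv_pow, pderiv_linPoly]
      simp [Nat.sub_sub]
      ring
    have e3 : X i.castSucc * (C (l * a i : ℂ) * linPoly a ^ (l - 1)) =
        C (l * a i : ℂ) * X i.castSucc * linPoly a ^ (l - 1) := by ring
    have e4 : (2 * T * if ¬(i.castSucc ∈ I ↔ i.val < j) then 1 else 0 : ℂ) =
        T * (1 - hessSign j i.castSucc) +
          ((2 * T * if i.castSucc ∈ I then hess j i.castSucc else 0 : ℝ) : ℂ) := by
      have : hess j i.castSucc = hessSign j i.castSucc := if_neg hi
      rw [this]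
      simp only [hessSign, Fin.val_castSucc]
      by_cases h1 : i.castSucc ∈ I <;> by_cases h2 : i.val < j <;> simp [h1, h2] <;> ring
    rw [LinearMap.add_apply, LinearMap.comp_apply, raise_lower_polyTest T j hi, e2, e1, e3, e4,
      polyTest_add, polyTest_add, polyTest_C_mul, polyTest_C_mul, polyTest_C_mul, polyTest_C_mul,
      LinearMap.smul_apply, LinearMap.id_apply]
    module
  have hX : ∑ i : Fin m, polyTest T (C (l * a i : ℂ) * X i.castSucc * linPoly a ^ (l - 1)) hs =
      (l : ℂ) • polyTest T (linPoly a ^ l) hs := by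
    have hsum : ∀ (S : Finset (Fin m)) (Q : Fin m → MvPolynomial (Fin (m + 1)) ℂ),
        ∑ i ∈ S, polyTest T (Q i) hs = polyTest T (∑ i ∈ S, Q i) hs := by
      intro S Q
      refine Subtype.ext (funext fun Z => ?_)
      simp [polyTest, polyExp, Finset.sum_mul]
    rw [hsum, ← polyTest_C_mul]
    congr 1
    rcases l with _ | l
    · simp
    · rw [Nat.add_sub_cancel, ← Finset.sum_mul, pow_succ', ← mul_assoc]
      congr 1
      rw [linPoly, Finset.mul_sum]
      exact Finset.sum_congr rfl fun i _ => by rw [C_mul, mul_assoc]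
  have hcard : (∑ i : Fin m, if ¬(i.castSucc ∈ I ↔ i.val < j) then (1 : ℂ) else 0) =
      excess j I := by
    rw [excess, Finset.sum_boole]
  rw [hlast, Finset.sum_congr rfl fun i _ => htan i]
  simp only [Finset.sum_add_distrib, Finset.sum_neg_distrib, ← Finset.sum_smul, ← Finset.smul_sum,
    ← Finset.mul_sum, hX, hcard]
  module

/-- Normal exponentials with a difference vanishing on the boundary satisfy the Dirichlet form of
the boundary condition. -/
theorem bdryCond_of_mem {m : ℕ} {T : ℝ} (hT : 0 < T) (j : ℕ) {I : Finset (Fin (m + 1))}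
    (hI : Fin.last m ∈ I) (P : MvPolynomial (Fin (m + 1)) ℂ) {s t : ℂ} (hs : 0 < s.re)
    (ht : 0 < t.re) : BdryCond j I (polyTest T P hs - polyTest T P ht) := by
  rw [BdryCond, if_pos hI]
  refine ⟨polyTest_sub_mem_bdrySpace hT P hs ht, fun i hi => ?_⟩
  have : gradPoly T i P s = gradPoly T i P t := by
    rw [gradPoly, gradPoly, if_neg hi, if_neg hi]
  rw [map_sub, lower_polyTest, lower_polyTest, this]
  exact polyTest_sub_mem_bdrySpace hT _ hs ht

open MvPolynomial in
theorem bdryCond_of_notMem {m : ℕ} {T : ℝ} (hT : 0 < T) (j : ℕ) {I : Finset (Fin (m + 1))}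
    (hI : Fin.last m ∉ I) {P : MvPolynomial (Fin (m + 1)) ℂ} (hP : pderiv (Fin.last m) P = 0)
    {s t : ℂ} (hs : 0 < s.re) (ht : 0 < t.re) :
    BdryCond j I (((T : ℂ) - t) • polyTest T P hs - ((T : ℂ) - s) • polyTest T P ht) := by
  rw [BdryCond, if_neg hI, map_sub, map_smul, map_smul, lower_last_polyTest T j hP,
    lower_last_polyTest T j hP]
  have e : ((T : ℂ) - t) • ((T : ℂ) - s) • polyTest T P hs -
      ((T : ℂ) - s) • ((T : ℂ) - t) • polyTest T P ht =
      (((T : ℂ) - s) * ((T : ℂ) - t)) • (polyTest T P hs - polyTest T P ht) := by module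
  rw [e]
  exact Submodule.smul_mem _ _ (polyTest_sub_mem_bdrySpace hT P hs ht)

theorem BdryCond.smul {m : ℕ} {T : ℝ} {j : ℕ} {I : Finset (Fin (m + 1))} {u : testSpace m T}
    (h : BdryCond j I u) (z : ℂ) : BdryCond j I (z • u) := by
  rw [BdryCond] at h ⊢
  simp only [map_smul]
  split_ifs at h ⊢
  · exact ⟨Submodule.smul_mem _ _ h.1, fun i hi => Submodule.smul_mem _ _ (h.2 i hi)⟩
  · exact Submodule.smul_mem _ _ h

/-! ### The coefficients of an eigenform -/

theorem memLp_coeff {m : ℕ} (w : L2Forms m) (I : Finset (Fin (m + 1))) :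
    MemLp (fun Z => (w Z I : ℂ)) 2 (μ m) := by
  have h1 : MemLp (fun Z => w Z I) 2 (μ m) :=
    (EuclideanSpace.proj (𝕜 := ℝ) I : Lam m →L[ℝ] ℝ).comp_memLp' (Lp.memLp w)
  exact Complex.ofRealCLM.comp_memLp' h1

/-- The pairing of the coefficient `w_I` of a form `w` with complex test functions. -/
def coeffPairing {m : ℕ} {T : ℝ} (hT : 0 < T) (w : L2Forms m) (I : Finset (Fin (m + 1))) :
    testSpace m T →ₗ[ℂ] ℂ where
  toFun φ := ∫ Z, (w Z I : ℂ) * φ.1 Z ∂(μ m)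
  map_add' φ ψ := by
    refine Eq.trans ?_ (integral_add
      ((memLp_coeff w I).integrable_mul (memLp_of_mem_testSpace hT φ.2))
      ((memLp_coeff w I).integrable_mul (memLp_of_mem_testSpace hT ψ.2)))
    simp [mul_add]
  map_smul' z φ := by
    simp only [Submodule.coe_smul, Pi.smul_apply, smul_eq_mul, RingHom.id_apply]
    rw [← integral_const_mul]
    simp [mul_left_comm]

theorem inner_formLp_basisVec {m : ℕ} {T : ℝ} (hT : 0 < T) (w : L2Forms m)
    (I : Finset (Fin (m + 1))) (φ : testSpace m T) :
    ⟪w, formLp hT φ (basisVec I)⟫_ℝ = (coeffPairing hT w I φ).re := by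
  have hi : Integrable (fun Z => (w Z I : ℂ) * φ.1 Z) (μ m) :=
    (memLp_coeff w I).integrable_mul (memLp_of_mem_testSpace hT φ.2)
  have h1 : (coeffPairing hT w I φ).re = ∫ Z, ((w Z I : ℂ) * φ.1 Z).re ∂(μ m) :=
    (Complex.reCLM.integral_comp_comm hi).symm
  rw [inner_formLp, h1]
  refine integral_congr_ae (Filter.Eventually.of_forall fun Z => ?_)
  have : ⟪basisVec I, w Z⟫_ℝ = w Z I := by
    rw [EuclideanSpace.inner_single_left]
    simp
  simp [this, mul_comm]

/-- An eigenform is a weak eigenform: it can be tested against all test forms that satisfy the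
boundary condition. -/
theorem coeffPairing_ham {m : ℕ} {T : ℝ} (hT : 0 < T) {j : ℕ} {c lam : ℝ}
    (hd : Dense ((modelDT m j c T).domain : Set (L2Forms m))) {w : L2Forms m}
    (hw : (w, lam • w) ∈ (wittenLaplacian m j c T).graph) {I : Finset (Fin (m + 1))}
    {u : testSpace m T} (hu : BdryCond j I u) :
    coeffPairing hT w I (ham j I u) = lam * coeffPairing hT w I u := by
  have hre : ∀ v : testSpace m T, BdryCond j I v →
      (coeffPairing hT w I (ham j I v)).re = lam * (coeffPairing hT w I v).re := by
    intro v hv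
    have h := inner_gaffney_symm hd hw (formLp_mem_graph_wittenLaplacian hT (c := c) hd hv)
    rw [real_inner_smul_left, inner_formLp_basisVec, inner_formLp_basisVec] at h
    exact h.symm
  -- `w` is real, so the test functions `u` and `i u` give the real and imaginary parts
  have h1 := hre u hu
  have h2 := hre (Complex.I • u) (hu.smul _)
  simp only [map_smul, smul_eq_mul, Complex.I_mul_re] at h2
  refine Complex.ext ?_ ?_
  · simpa using h1
  · simp only [Complex.mul_im, Complex.ofReal_re, Complex.ofReal_im, zero_mul, add_zero]
    linarith

/-! ### Completeness of the test functions -/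

/-- Injectivity of the Fourier transform on real integrable functions. -/
theorem ae_eq_zero_of_integral_cexp_inner {V : Type*} [NormedAddCommGroup V]
    [InnerProductSpace ℝ V] [CompleteSpace V] [MeasurableSpace V] [BorelSpace V]
    [SecondCountableTopology V] {ν : Measure V} [SigmaFinite ν] {k : V → ℝ} (hk : Integrable k ν)
    (h : ∀ t, ∫ x, (k x : ℂ) * Complex.exp (⟪x, t⟫_ℝ * Complex.I) ∂ν = 0) : k =ᵐ[ν] 0 := by
  -- the positive and negative parts of `k` define finite measures with equal Fourier transforms
  have hfin : ∀ {g : V → ℝ}, Integrable g ν →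
      IsFiniteMeasure (ν.withDensity fun x => ENNReal.ofReal (g x)) := fun hg =>
    isFiniteMeasure_withDensity_ofReal hg.2
  have h1 := hfin hk
  have h2 := hfin hk.neg
  have hint : ∀ {g : V → ℝ}, Integrable g ν → ∀ t,
      charFun (ν.withDensity fun x => ENNReal.ofReal (g x)) t =
        ∫ x, ((max (g x) 0 : ℝ) : ℂ) * Complex.exp (⟪x, t⟫_ℝ * Complex.I) ∂ν := by
    intro g hg t
    rw [charFun_apply, integral_withDensity_eq_integral_toReal_smul₀ hg.1.aemeasurable.ennreal_ofReal
      (Filter.Eventually.of_forall fun _ => ENNReal.ofReal_lt_top)]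
    refine integral_congr_ae (Filter.Eventually.of_forall fun x => ?_)
    simp only [ENNReal.toReal_ofReal', Complex.real_smul]
  have hI : ∀ {g : V → ℝ}, Integrable g ν → ∀ t, Integrable
      (fun x => ((max (g x) 0 : ℝ) : ℂ) * Complex.exp (⟪x, t⟫_ℝ * Complex.I)) ν := by
    intro g hg t
    refine (hg.pos_part.ofReal (𝕜 := ℂ)).mul_bdd (c := 1) (Continuous.aestronglyMeasurable
      (by fun_prop)) (Filter.Eventually.of_forall fun x => ?_)
    rw [Complex.norm_exp_ofReal_mul_I]
  have heq : (ν.withDensity fun x => ENNReal.ofReal (k x)) =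
      ν.withDensity fun x => ENNReal.ofReal ((-k) x) := by
    refine Measure.ext_of_charFun (funext fun t => ?_)
    rw [hint hk, hint hk.neg, ← sub_eq_zero, ← integral_sub (hI hk t) (hI hk.neg t), ← h t]
    refine integral_congr_ae (Filter.Eventually.of_forall fun x => ?_)
    simp only [Pi.neg_apply]
    rw [← sub_mul, ← Complex.ofReal_sub]
    congr 2
    rcases le_total (k x) 0 with hx | hx <;> simp [hx]
  rw [withDensity_eq_iff_of_sigmaFinite hk.1.aemeasurable.ennreal_ofReal
    hk.neg.1.aemeasurable.ennreal_ofReal] at heq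
  filter_upwards [heq] with x hx
  rw [Pi.neg_apply] at hx
  rw [Pi.zero_apply]
  rcases le_total (k x) 0 with h0 | h0
  · rw [ENNReal.ofReal_of_nonpos h0, eq_comm, ENNReal.ofReal_eq_zero] at hx
    linarith
  · rw [ENNReal.ofReal_of_nonpos (neg_nonpos.2 h0), ENNReal.ofReal_eq_zero] at hx
    linarith

theorem integrable_exp_linear_mul_gauss {b : ℝ} (hb : 0 < b) (a : ℝ) :
    Integrable fun x : ℝ => Real.exp (-b * x ^ 2 + a * x) := by
  have h := (integrable_cexp_quadratic (b := (b : ℂ)) (by simpa using hb) (a : ℂ) 0).norm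
  refine h.congr (Filter.Eventually.of_forall fun x => ?_)
  have : (-(b : ℂ) * (x : ℂ) ^ 2 + a * x + 0) = ((-b * x ^ 2 + a * x : ℝ) : ℂ) := by
    push_cast; ring
  simp only [this, Complex.norm_exp_ofReal]

theorem memLp_exp_mul_gaussExp {m : ℕ} {T : ℝ} (hT : 0 < T) (a : Fin m → ℝ) {s : ℂ}
    (hs : 0 < s.re) :
    MemLp (fun Z : E m => Real.exp (∑ i, a i * Z i.castSucc) * ‖gaussExp T s Z‖) 2 (μ m) := by
  have hc : Continuous fun Z : E m =>
      Real.exp (∑ i, a i * Z i.castSucc) * ‖gaussExp T s Z‖ := by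
    have := (contDiff_gaussExp (m := m) T s).continuous
    fun_prop
  refine (memLp_two_iff_integrable_sq hc.aestronglyMeasurable).2 ?_
  have h := integrable_prod_coord (m := m)
    (f := fun i x => Real.exp (-T * x ^ 2 + 2 * a i * x))
    (g := fun x => x ^ 0 * Real.exp (-(2 * s.re) * x))
    (fun i => integrable_exp_linear_mul_gauss hT _) (integrableOn_pow_mul_exp (by linarith) _)
  refine h.congr (Filter.Eventually.of_forall fun Z => ?_)
  simp only [norm_gaussExp, ← Real.exp_sum, ← Real.exp_add, ← Real.exp_nat_mul, pow_zero, one_mul]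
  congr 1
  push_cast
  rw [mul_add, mul_add, Finset.mul_sum, Finset.mul_sum, ← add_assoc, ← Finset.sum_add_distrib]
  congr 1
  · exact Finset.sum_congr rfl fun i _ => by ring
  · ring

theorem eval_linPoly {m : ℕ} (a : Fin m → ℝ) (Z : E m) :
    MvPolynomial.eval (fun i => (Z i : ℂ)) (linPoly a) =
      ((∑ i, a i * Z i.castSucc : ℝ) : ℂ) := by
  simp [linPoly]

/-- A square integrable function orthogonal to all powers of linear forms in `Z'` times the
functions `gaussExp T s` on a line `Re s = ρ` vanishes: summing the exponential series, all
Fourier coefficients of its product with the Gaussian vanish. -/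
theorem ae_eq_zero_of_integral_polyExp {m : ℕ} {T : ℝ} (hT : 0 < T) {ρ : ℝ} (hρ : 0 < ρ)
    {h : E m → ℝ} (hh : MemLp h 2 (μ m))
    (h0 : ∀ (a : Fin m → ℝ) (l : ℕ) (b : ℝ),
      ∫ Z, (h Z : ℂ) * polyExp T (linPoly a ^ l) (ρ + b * Complex.I) Z ∂(μ m) = 0) :
    h =ᵐ[μ m] 0 := by
  have hρ' : 0 < (ρ : ℂ).re := by simpa using hρ
  have hg : MemLp (fun Z : E m => ‖gaussExp T ρ Z‖) 2 (μ m) := by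
    simpa using memLp_exp_mul_gaussExp hT (fun _ : Fin m => 0) hρ'
  have hk : Integrable (fun Z => h Z * ‖gaussExp T ρ Z‖) (μ m) := hh.integrable_mul hg
  have hzero : (fun Z => h Z * ‖gaussExp T ρ Z‖) =ᵐ[μ m] 0 := by
    have : SigmaFinite (μ m) := by unfold μ; infer_instance
    refine ae_eq_zero_of_integral_cexp_inner hk fun t => ?_
    set a : Fin m → ℝ := fun i => t i.castSucc with ha
    set s : ℂ := ρ + (-t (Fin.last m) : ℝ) * Complex.I with hs
    have hsre : s.re = ρ := by simp [hs]
    have hns : ∀ Z : E m, ‖gaussExp T s Z‖ = ‖gaussExp T ρ Z‖ := by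
      intro Z
      rw [norm_gaussExp, norm_gaussExp, hsre, Complex.ofReal_re]
    have hexp : ∀ Z : E m, (h Z : ℂ) * gaussExp T s Z *
        Complex.exp ((∑ i, a i * Z i.castSucc : ℝ) * Complex.I) =
        ((h Z * ‖gaussExp T ρ Z‖ : ℝ) : ℂ) * Complex.exp (⟪Z, t⟫_ℝ * Complex.I) := by
      intro Z
      have e1 : (‖gaussExp T ρ Z‖ : ℂ) = gaussExp T ρ Z := by
        rw [gaussExp_ofReal, Complex.norm_real, Real.norm_of_nonneg (Real.exp_pos _).le]
      rw [Complex.ofReal_mul, e1, mul_assoc, mul_assoc]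
      congr 1
      rw [gaussExp, gaussExp, ← Complex.exp_add, ← Complex.exp_add]
      congr 1
      have e2 : ⟪Z, t⟫_ℝ = ∑ i, a i * Z i.castSucc + t (Fin.last m) * Z (Fin.last m) := by
        rw [PiLp.inner_apply, Fin.sum_univ_castSucc]
        simp [ha]
      rw [e2, hs]
      push_cast
      ring
    set q : E m → ℝ := fun Z => ∑ i, a i * Z i.castSucc with hq
    have hsum := hasSum_integral_of_dominated_convergence (μ := μ m)
      (F := fun (l : ℕ) Z => (Complex.I ^ l / (l.factorial : ℂ)) *
        ((h Z : ℂ) * polyExp T (linPoly a ^ l) s Z))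
      (f := fun Z => (h Z : ℂ) * gaussExp T s Z * Complex.exp ((q Z : ℝ) * Complex.I))
      (fun (l : ℕ) Z => |h Z| * ‖gaussExp T ρ Z‖ * (|q Z| ^ l / l.factorial)) (fun l => ?_)
      (fun l => ?_) ?_ ?_ ?_
    · have h1 : ∀ l : ℕ, ∫ Z, (Complex.I ^ l / (l.factorial : ℂ)) *
          ((h Z : ℂ) * polyExp T (linPoly a ^ l) s Z) ∂(μ m) = 0 := by
        intro l
        rw [integral_const_mul, h0, mul_zero]
      simp only [h1] at hsum
      rw [← hsum.unique hasSum_zero]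
      exact integral_congr_ae (Filter.Eventually.of_forall fun Z => (hexp Z).symm)
    · exact ((Complex.continuous_ofReal.comp_aestronglyMeasurable hh.1).mul
        (contDiff_polyExp T _ s).continuous.aestronglyMeasurable).const_mul _
    · refine Filter.Eventually.of_forall fun Z => le_of_eq ?_
      simp only [polyExp, map_pow, eval_linPoly, norm_mul, norm_div, norm_pow, Complex.norm_I,
        one_pow, Complex.norm_natCast, Complex.norm_real, Real.norm_eq_abs, hns]
      ring
    · exact Filter.Eventually.of_forall fun Z =>
        (Real.summable_pow_div_factorial _).mul_left _
    · have h1 : ∀ Z, ∑' l : ℕ, |h Z| * ‖gaussExp T ρ Z‖ * (|q Z| ^ l / l.factorial) =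
          |h Z| * ‖gaussExp T ρ Z‖ * Real.exp |q Z| := by
        intro Z
        rw [tsum_mul_left, Real.exp_eq_exp_ℝ, NormedSpace.exp_eq_tsum_div]
      simp only [h1]
      have hp := memLp_exp_mul_gaussExp hT a hρ'
      have hn := memLp_exp_mul_gaussExp hT (-a) hρ'
      have hqc : Continuous q := by fun_prop
      refine (hh.norm.integrable_mul (hp.add hn)).mono' ?_ (Filter.Eventually.of_forall fun Z => ?_)
      · exact ((hh.1.norm.mul hg.1)).mul
          (Real.continuous_exp.comp hqc.abs).aestronglyMeasurable
      · have e3 : ∑ i, (-a) i * Z i.castSucc = -q Z := by simp [hq]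
        have e4 : Real.exp |q Z| ≤ Real.exp (q Z) + Real.exp (-q Z) := by
          rcases abs_choice (q Z) with hc | hc <;> rw [hc]
          · linarith [Real.exp_pos (-q Z)]
          · linarith [Real.exp_pos (q Z)]
        simp only [Pi.mul_apply, Pi.add_apply, e3]
        rw [Real.norm_of_nonneg (by positivity), Real.norm_eq_abs, mul_assoc]
        refine mul_le_mul_of_nonneg_left ?_ (abs_nonneg _)
        rw [← add_mul, mul_comm]
        exact mul_le_mul_of_nonneg_right e4 (norm_nonneg _)
    · refine Filter.Eventually.of_forall fun Z => ?_
      have h1 := (NormedSpace.expSeries_div_hasSum_exp ((q Z : ℂ) * Complex.I)).mul_left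
        ((h Z : ℂ) * gaussExp T s Z)
      rw [← Complex.exp_eq_exp_ℂ] at h1
      refine h1.congr_fun fun l => ?_
      simp only [polyExp, map_pow, eval_linPoly, mul_pow]
      ring
  filter_upwards [hzero] with Z hZ
  have : ‖gaussExp T ρ Z‖ ≠ 0 := by simp [gaussExp]
  simpa [this] using hZ

/-- The test forms with parameters on a line `Re s = ρ` are complete in `L²`. -/
theorem eq_zero_of_coeffPairing_eq_zero {m : ℕ} {T : ℝ} (hT : 0 < T) {ρ : ℝ} (hρ : 0 < ρ)
    {w : L2Forms m}
    (h : ∀ (I : Finset (Fin (m + 1))) (a : Fin m → ℝ) (l : ℕ) (s : ℂ) (hs : 0 < s.re), s.re = ρ →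
      coeffPairing hT w I (polyTest T (linPoly a ^ l) hs) = 0) : w = 0 := by
  have hI : ∀ I, ∀ᵐ Z ∂(μ m), w Z I = 0 := by
    intro I
    have hw : MemLp (fun Z => w Z I) 2 (μ m) :=
      (EuclideanSpace.proj (𝕜 := ℝ) I : Lam m →L[ℝ] ℝ).comp_memLp' (Lp.memLp w)
    refine ae_eq_zero_of_integral_polyExp hT hρ hw fun a l b => ?_
    have hre : ((ρ : ℂ) + b * Complex.I).re = ρ := by simp
    exact h I a l _ (hρ.trans_eq hre.symm) hre
  refine Lp.ext ?_
  filter_upwards [ae_all_iff.2 hI, Lp.coeFn_zero (Lam m) 2 (μ m)] with Z hZ h0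
  rw [h0]
  ext I
  simpa using hZ I

/-- The operator `d_T` is densely defined, since its domain contains the test forms. -/
theorem dense_domain_modelDT {m : ℕ} {T : ℝ} (hT : 0 < T) (j : ℕ) (c : ℝ) :
    Dense ((modelDT m j c T).domain : Set (L2Forms m)) := by
  rw [Submodule.dense_iff_topologicalClosure_eq_top, Submodule.topologicalClosure_eq_top_iff,
    Submodule.eq_bot_iff]
  intro w hw
  refine eq_zero_of_coeffPairing_eq_zero hT one_pos fun I a l s hs _ => ?_
  have hre : ∀ φ : testSpace m T, (coeffPairing hT w I φ).re = 0 := by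
    intro φ
    rw [← inner_formLp_basisVec]
    have := LinearPMap.mem_domain_of_mem_graph (dForm_mem_graph hT j c φ (basisVec I))
    exact (Submodule.mem_orthogonal' _ _).1 hw _ this
  -- multiplying the test function by `i` gives the imaginary part
  refine Complex.ext (hre _) ?_
  have := hre (Complex.I • polyTest T (linPoly a ^ l) hs)
  rw [map_smul, smul_eq_mul, Complex.I_mul_re] at this
  simpa using this

/-! ### The Laplace transform of an eigenform -/

/-- The transform `∫ w_I (a · Z')^l exp (-T |Z'|² / 2 - s Z_n)` of the coefficient `w_I`. -/
def coeffTransform {m : ℕ} (T : ℝ) (w : L2Forms m) (I : Finset (Fin (m + 1))) (a : Fin m → ℝ)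
    (l : ℕ) (s : ℂ) : ℂ :=
  ∫ Z, (w Z I : ℂ) * polyExp T (linPoly a ^ l) s Z ∂(μ m)

/-- The value of `s²` at which the equation for the transform of degree `l` of an eigenform
degenerates. -/
def resonance {m : ℕ} (T lam : ℝ) (j : ℕ) (I : Finset (Fin (m + 1))) (l : ℕ) : ℝ :=
  T ^ 2 + 2 * T * (l + excess j I) - lam

/-- The pairing of an eigenform `w` of eigenvalue `lam` with `ham j I - lam`, applied to a test
function that need not satisfy the boundary condition. -/
def boundaryTerm {m : ℕ} (T lam : ℝ) (j : ℕ) (w : L2Forms m) (I : Finset (Fin (m + 1)))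
    (a : Fin m → ℝ) (l : ℕ) (s : ℂ) : ℂ :=
  (resonance T lam j I l - s ^ 2) * coeffTransform T w I a l s -
    (l * (l - 1 : ℕ) * ∑ i, (a i : ℂ) ^ 2) * coeffTransform T w I a (l - 2) s

theorem coeffPairing_polyTest {m : ℕ} {T : ℝ} (hT : 0 < T) (w : L2Forms m)
    (I : Finset (Fin (m + 1))) (a : Fin m → ℝ) (l : ℕ) {s : ℂ} (hs : 0 < s.re) :
    coeffPairing hT w I (polyTest T (linPoly a ^ l) hs) = coeffTransform T w I a l s :=
  rfl

theorem boundaryTerm_eq {m : ℕ} {T : ℝ} (hT : 0 < T) (lam : ℝ) (j : ℕ) (w : L2Forms m)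
    (I : Finset (Fin (m + 1))) (a : Fin m → ℝ) (l : ℕ) {s : ℂ} (hs : 0 < s.re) :
    boundaryTerm T lam j w I a l s =
      coeffPairing hT w I (ham j I (polyTest T (linPoly a ^ l) hs)) -
        lam * coeffPairing hT w I (polyTest T (linPoly a ^ l) hs) := by
  rw [ham_polyTest, map_sub, map_smul, map_smul, coeffPairing_polyTest, coeffPairing_polyTest,
    boundaryTerm, resonance]
  push_cast
  simp only [smul_eq_mul]
  ring

section Eigenform

variable {m : ℕ} {T : ℝ} {j : ℕ} {c lam : ℝ} {w : L2Forms m}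

theorem boundaryTerm_of_mem (hT : 0 < T)
    (hw : (w, lam • w) ∈ (wittenLaplacian m j c T).graph) {I : Finset (Fin (m + 1))}
    (hI : Fin.last m ∈ I) (a : Fin m → ℝ) (l : ℕ) {s t : ℂ} (hs : 0 < s.re) (ht : 0 < t.re) :
    boundaryTerm T lam j w I a l s = boundaryTerm T lam j w I a l t := by
  have h := coeffPairing_ham hT (dense_domain_modelDT hT j c) hw
    (bdryCond_of_mem hT j hI (linPoly a ^ l) hs ht)
  simp only [map_sub] at h
  rw [boundaryTerm_eq hT lam j w I a l hs, boundaryTerm_eq hT lam j w I a l ht]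
  linear_combination h

theorem boundaryTerm_of_notMem (hT : 0 < T)
    (hw : (w, lam • w) ∈ (wittenLaplacian m j c T).graph) {I : Finset (Fin (m + 1))}
    (hI : Fin.last m ∉ I) (a : Fin m → ℝ) (l : ℕ) {s t : ℂ} (hs : 0 < s.re) (ht : 0 < t.re) :
    (T - t) * boundaryTerm T lam j w I a l s = (T - s) * boundaryTerm T lam j w I a l t := by
  have h := coeffPairing_ham hT (dense_domain_modelDT hT j c) hw
    (bdryCond_of_notMem hT j hI (pderiv_last_linPoly_pow a l) hs ht)
  simp only [map_sub, map_smul, smul_eq_mul] at h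
  rw [boundaryTerm_eq hT lam j w I a l hs, boundaryTerm_eq hT lam j w I a l ht]
  linear_combination h

/-- The boundary terms vanish for all parameters as soon as one of them vanishes, unless this
happens at the parameter `T` for which the test function itself satisfies the Robin condition. -/
theorem boundaryTerm_eq_zero (hT : 0 < T)
    (hw : (w, lam • w) ∈ (wittenLaplacian m j c T).graph) {I : Finset (Fin (m + 1))}
    {a : Fin m → ℝ} {l : ℕ} {s t : ℂ} (hs : 0 < s.re) (ht : 0 < t.re) (htT : t ≠ T)
    (h0 : boundaryTerm T lam j w I a l t = 0) : boundaryTerm T lam j w I a l s = 0 := by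
  by_cases hI : Fin.last m ∈ I
  · rw [boundaryTerm_of_mem hT hw hI a l hs ht, h0]
  · have h := boundaryTerm_of_notMem hT hw hI a l hs ht
    rw [h0, mul_zero] at h
    exact (mul_eq_zero.1 h).resolve_left (sub_ne_zero.2 htT.symm)

/-- The Laplace transform of a square integrable function is `o(1 / ε)` at distance `ε` from the
imaginary axis. -/
theorem tendsto_mul_coeffTransform_zero (hT : 0 < T) (w : L2Forms m) (I : Finset (Fin (m + 1)))
    (a : Fin m → ℝ) {σ : ℂ} (hσ : 0 ≤ σ.re) :
    Filter.Tendsto (fun ε : ℝ => (ε : ℂ) * coeffTransform T w I a 0 (σ + ε))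
      (nhdsWithin 0 (Set.Ioi 0)) (nhds 0) := by
  set G : E m → ℝ := fun Z => ∏ i : Fin m, Real.exp (-(T / 2) * Z i.castSucc ^ 2) with hG
  have hGc : Continuous G := by fun_prop
  have hw : MemLp (fun Z => (w Z I : ℂ)) 2 (μ m) := memLp_coeff w I
  have hB : MemLp (fun Z : E m => G Z * (1 + |Z (Fin.last m)|)⁻¹) 2 (μ m) := by
    have hc : Continuous fun Z : E m => G Z * (1 + |Z (Fin.last m)|)⁻¹ := by
      refine hGc.mul (Continuous.inv₀ (by fun_prop) fun Z => ?_)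
      positivity
    refine (memLp_two_iff_integrable_sq hc.aestronglyMeasurable).2 ?_
    have h := integrable_prod_coord (m := m)
      (f := fun _ x => Real.exp (-T * x ^ 2)) (g := fun x => (1 + x ^ 2)⁻¹)
      (fun i => integrable_exp_neg_mul_sq hT) integrable_inv_one_add_sq.integrableOn
    refine h.mono' (hc.pow 2).aestronglyMeasurable (Filter.Eventually.of_forall fun Z => ?_)
    have e1 : G Z ^ 2 = ∏ i : Fin m, Real.exp (-T * Z i.castSucc ^ 2) := by
      simp only [hG, ← Finset.prod_pow, ← Real.exp_nat_mul]
      refine Finset.prod_congr rfl fun i _ => ?_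
      congr 1
      push_cast
      ring
    rw [Real.norm_of_nonneg (by positivity), mul_pow, e1]
    refine mul_le_mul_of_nonneg_left ?_ (Finset.prod_nonneg fun i _ => (Real.exp_pos _).le)
    rw [inv_pow]
    refine inv_anti₀ (by positivity) ?_
    nlinarith [abs_nonneg (Z (Fin.last m)), sq_abs (Z (Fin.last m))]
  have hnorm : ∀ (ε : ℝ) (Z : E m), 0 < ε → 0 < Z (Fin.last m) →
      ‖gaussExp T (σ + ε) Z‖ ≤ G Z * Real.exp (-(ε * Z (Fin.last m))) := by
    intro ε Z _ hZ
    rw [norm_gaussExp]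
    refine mul_le_mul_of_nonneg_left (Real.exp_le_exp.2 ?_)
      (Finset.prod_nonneg fun i _ => (Real.exp_pos _).le)
    simp only [Complex.add_re, Complex.ofReal_re]
    nlinarith [mul_nonneg hσ hZ.le]
  have hfun : ∀ ε : ℝ, (ε : ℂ) * coeffTransform T w I a 0 (σ + ε) =
      ∫ Z, (w Z I : ℂ) * (ε * gaussExp T (σ + ε) Z) ∂(μ m) := by
    intro ε
    rw [coeffTransform, ← integral_const_mul]
    refine integral_congr_ae (Filter.Eventually.of_forall fun Z => ?_)
    simp only [polyExp, pow_zero, map_one, one_mul]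
    ring
  simp only [hfun]
  have hzero : (0 : ℂ) = ∫ _ : E m, (0 : ℂ) ∂(μ m) := by simp
  rw [hzero]
  have hmem : ∀ᶠ ε : ℝ in nhdsWithin 0 (Set.Ioi 0), 0 < ε ∧ ε < 1 :=
    Ioo_mem_nhdsGT one_pos
  refine tendsto_integral_filter_of_dominated_convergence
    (fun Z => ‖(w Z I : ℂ)‖ * (2 * (G Z * (1 + |Z (Fin.last m)|)⁻¹))) ?_ ?_ ?_ ?_
  · exact Filter.Eventually.of_forall fun ε => hw.1.mul
      ((contDiff_gaussExp T _).continuous.aestronglyMeasurable.const_mul _)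
  · filter_upwards [hmem] with ε hε
    filter_upwards [ae_pos_last m] with Z hZ
    rw [norm_mul]
    refine mul_le_mul_of_nonneg_left ?_ (norm_nonneg _)
    rw [norm_mul, Complex.norm_real, Real.norm_of_nonneg hε.1.le]
    refine (mul_le_mul_of_nonneg_left (hnorm ε Z hε.1 hZ) hε.1.le).trans ?_
    have hGp : 0 ≤ G Z := Finset.prod_nonneg fun i _ => (Real.exp_pos _).le
    set z := Z (Fin.last m)
    rw [abs_of_pos hZ]
    have h1 : ε * Real.exp (-(ε * z)) ≤ 2 * (1 + z)⁻¹ := by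
      rw [← div_eq_mul_inv, le_div_iff₀ (by linarith)]
      have hx : 0 < ε * z := mul_pos hε.1 hZ
      have h2 : Real.exp (-(ε * z)) ≤ 1 := Real.exp_le_one_iff.2 (by linarith)
      have h3 : ε * z * Real.exp (-(ε * z)) ≤ 1 := by
        rw [Real.exp_neg, ← div_eq_mul_inv, div_le_one (Real.exp_pos _)]
        linarith [Real.add_one_le_exp (ε * z)]
      nlinarith [Real.exp_pos (-(ε * z))]
    calc ε * (G Z * Real.exp (-(ε * z))) = G Z * (ε * Real.exp (-(ε * z))) := by ring
      _ ≤ G Z * (2 * (1 + z)⁻¹) := mul_le_mul_of_nonneg_left h1 hGp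
      _ = 2 * (G Z * (1 + z)⁻¹) := by ring
  · exact hw.norm.integrable_mul (hB.const_mul 2)
  · filter_upwards [ae_pos_last m] with Z hZ
    have hc : Continuous fun ε : ℝ => (w Z I : ℂ) * (ε * gaussExp T (σ + ε) Z) := by
      unfold gaussExp
      fun_prop
    have := (hc.tendsto 0).mono_left (nhdsWithin_le_nhds (s := Set.Ioi (0 : ℝ)))
    simpa using this

/-- In the lowest degree the boundary terms vanish, except at the eigenvalue zero under the Robin
condition, where the vanishing of one transform has to be required. -/
theorem boundaryTerm_zero_eq_zero (hT : 0 < T)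
    (hw : (w, lam • w) ∈ (wittenLaplacian m j c T).graph) {I : Finset (Fin (m + 1))}
    (a : Fin m → ℝ) (hex : excess j I = 0)
    (horth : lam = 0 → Fin.last m ∉ I → coeffTransform T w I a 0 (2 * T) = 0) {s : ℂ}
    (hs : 0 < s.re) : boundaryTerm T lam j w I a 0 s = 0 := by
  have hbt : ∀ t : ℂ, boundaryTerm T lam j w I a 0 t =
      ((T : ℂ) ^ 2 - lam - t ^ 2) * coeffTransform T w I a 0 t := by
    intro t
    simp [boundaryTerm, resonance, hex]
  obtain ⟨σ, hσ, hσ2⟩ : ∃ σ : ℂ, 0 ≤ σ.re ∧ σ ^ 2 = (T : ℂ) ^ 2 - lam := by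
    obtain ⟨z, hz⟩ := IsAlgClosed.exists_pow_nat_eq ((T : ℂ) ^ 2 - lam) two_pos
    rcases le_total 0 z.re with h | h
    · exact ⟨z, h, hz⟩
    · exact ⟨-z, by simpa using h, by rw [neg_sq, hz]⟩
  -- `σ` itself is not an admissible parameter if it is imaginary, hence the limit from the right
  have hlim : Filter.Tendsto (fun ε : ℝ => boundaryTerm T lam j w I a 0 (σ + ε))
      (nhdsWithin 0 (Set.Ioi 0)) (nhds 0) := by
    have h1 : Filter.Tendsto (fun ε : ℝ => -(2 * σ + ε)) (nhdsWithin 0 (Set.Ioi 0))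
        (nhds (-(2 * σ + (0 : ℝ)))) := by
      have hc : Continuous fun ε : ℝ => -(2 * σ + (ε : ℂ)) := by fun_prop
      exact (hc.tendsto 0).mono_left nhdsWithin_le_nhds
    have h2 := h1.mul (tendsto_mul_coeffTransform_zero hT w I a hσ)
    rw [mul_zero] at h2
    refine h2.congr fun ε => ?_
    rw [hbt, ← hσ2]
    ring
  have hpos : ∀ᶠ ε : ℝ in nhdsWithin 0 (Set.Ioi 0), 0 < (σ + ε).re := by
    filter_upwards [self_mem_nhdsWithin] with ε hε
    simp only [Complex.add_re, Complex.ofReal_re]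
    linarith [Set.mem_Ioi.1 hε]
  by_cases hI : Fin.last m ∈ I
  · refine tendsto_nhds_unique (tendsto_const_nhds.congr' ?_) hlim
    filter_upwards [hpos] with ε hε
    exact boundaryTerm_of_mem hT hw hI a 0 hs hε
  · by_cases hσT : σ = T
    · have hlam : lam = 0 := by
        rw [hσT] at hσ2
        have : (lam : ℂ) = 0 := by linear_combination hσ2
        exact_mod_cast this
      have hT2 : (0 : ℝ) < (2 * T : ℂ).re := by simpa using hT
      -- the parameter `T` gives no information, as both sides of the relation vanish there
      refine boundaryTerm_eq_zero hT hw hs hT2 ?_ ?_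
      · intro h
        have : (T : ℂ) = 0 := by linear_combination h
        exact hT.ne' (by exact_mod_cast this)
      · rw [hbt, horth hlam hI, mul_zero]
    · have h1 : Filter.Tendsto (fun ε : ℝ => ((T : ℂ) - (σ + ε)) * boundaryTerm T lam j w I a 0 s)
          (nhdsWithin 0 (Set.Ioi 0)) (nhds (((T : ℂ) - (σ + (0 : ℝ))) *
            boundaryTerm T lam j w I a 0 s)) := by
        have hc : Continuous fun ε : ℝ =>
          ((T : ℂ) - (σ + ε)) * boundaryTerm T lam j w I a 0 s := by fun_prop
        exact (hc.tendsto 0).mono_left nhdsWithin_le_nhds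
      have h2 := hlim.const_mul ((T : ℂ) - s)
      rw [mul_zero] at h2
      have h3 := tendsto_nhds_unique (h1.congr' (by
        filter_upwards [hpos] with ε hε
        exact boundaryTerm_of_notMem hT hw hI a 0 hs hε)) h2
      refine (mul_eq_zero.1 h3).resolve_left ?_
      rw [Complex.ofReal_zero, add_zero]
      exact sub_ne_zero.2 (Ne.symm hσT)

/-- The transforms of an eigenform of eigenvalue less than `2 T` vanish off the resonances. The
induction has step two, because the equation for degree `l` involves degree `l - 2`. -/
theorem coeffTransform_eq_zero (hT : 0 < T)
    (hw : (w, lam • w) ∈ (wittenLaplacian m j c T).graph) (hlam : lam < 2 * T)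
    {I : Finset (Fin (m + 1))} (a : Fin m → ℝ)
    (horth : lam = 0 → excess j I = 0 → Fin.last m ∉ I → coeffTransform T w I a 0 (2 * T) = 0)
    (l : ℕ) {s : ℂ} (hs : 0 < s.re)
    (hres : ∀ l' ≤ l, s ^ 2 ≠ resonance T lam j I l') : coeffTransform T w I a l s = 0 := by
  induction l using Nat.strong_induction_on generalizing s with
  | _ l ih =>
    have hstep : ∀ {t : ℂ}, 0 < t.re → (∀ l' < l, l' + 2 ≤ l → t ^ 2 ≠ resonance T lam j I l') →
        (l * (l - 1 : ℕ) * ∑ i, (a i : ℂ) ^ 2) * coeffTransform T w I a (l - 2) t = 0 := by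
      intro t ht hr
      rcases Nat.lt_or_ge l 2 with hl | hl
      · have : l * (l - 1) = 0 := by interval_cases l <;> rfl
        rw [← Nat.cast_mul, this]
        simp
      · rw [ih (l - 2) (by omega) ht fun l' hl' => hr l' (by omega) (by omega), mul_zero]
    have hb : boundaryTerm T lam j w I a l s = 0 := by
      rcases Nat.eq_zero_or_pos (l + excess j I) with h0 | h0
      · obtain ⟨rfl, hex⟩ := Nat.add_eq_zero_iff.1 h0
        exact boundaryTerm_zero_eq_zero hT hw a hex (fun h => horth h hex) hs
      · -- at `t = √(resonance)`, which exceeds `T`, the leading coefficient vanishes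
        have h1 : (1 : ℝ) ≤ l + excess j I := by exact_mod_cast h0
        have hgt : T ^ 2 < resonance T lam j I l := by
          rw [resonance]
          nlinarith
        set t : ℝ := Real.sqrt (resonance T lam j I l) with ht
        have htT : T < t := Real.lt_sqrt_of_sq_lt hgt
        have ht2 : t ^ 2 = resonance T lam j I l :=
          Real.sq_sqrt ((sq_nonneg T).trans hgt.le)
        have hre : 0 < (t : ℂ).re := by simpa using hT.trans htT
        refine boundaryTerm_eq_zero hT hw hs hre (by exact_mod_cast htT.ne') ?_
        rw [boundaryTerm, hstep hre ?_, ← ht2]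
        · push_cast
          ring
        · intro l' hl' _ h
          have h2 : resonance T lam j I l = resonance T lam j I l' := by
            rw [← ht2]
            exact_mod_cast h
          have h3 : (l' : ℝ) < l := by exact_mod_cast hl'
          rw [resonance, resonance] at h2
          nlinarith
    rw [boundaryTerm, hstep hs fun l' hl' _ => hres l' hl'.le, sub_zero] at hb
    exact (mul_eq_zero.1 hb).resolve_left (sub_ne_zero.2 (hres l le_rfl).symm)

/-- An eigenform of eigenvalue less than `2 T` vanishes, provided that, in the case of a harmonic
form, the Laplace transforms of the coefficients that may carry the ground state vanish at `2 T`. -/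
theorem eq_zero_of_mem_graph_of_lt (hT : 0 < T)
    (hw : (w, lam • w) ∈ (wittenLaplacian m j c T).graph) (hlam : lam < 2 * T)
    (horth : lam = 0 → ∀ I : Finset (Fin (m + 1)), excess j I = 0 → Fin.last m ∉ I →
      ∀ a, coeffTransform T w I a 0 (2 * T) = 0) : w = 0 := by
  -- a line `Re s = ρ` with `ρ < T` on which no `s²` is resonant
  obtain ⟨ρ, hρ, hρT, hne⟩ : ∃ ρ : ℝ, 0 < ρ ∧ ρ < T ∧ ρ ^ 2 ≠ T ^ 2 - lam := by
    by_cases h : (T / 2) ^ 2 = T ^ 2 - lam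
    · refine ⟨T / 3, by linarith, by linarith, fun h' => ?_⟩
      nlinarith [pow_pos hT 2]
    · exact ⟨T / 2, by linarith, by linarith, h⟩
  refine eq_zero_of_coeffPairing_eq_zero hT hρ fun I a l s hs hsρ => ?_
  refine coeffTransform_eq_zero hT hw hlam a (fun h hex hI => horth h I hex hI a) l hs ?_
  intro l' _ h
  have him : s.re * s.im = 0 := by
    have := congrArg Complex.im h
    rw [pow_two, Complex.mul_im, Complex.ofReal_im] at this
    linarith
  have him0 : s.im = 0 := (mul_eq_zero.1 him).resolve_left hs.ne'
  have hre : ρ ^ 2 = resonance T lam j I l' := by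
    have := congrArg Complex.re h
    rw [pow_two, Complex.mul_re, Complex.ofReal_re, him0, hsρ] at this
    linarith
  rcases Nat.eq_zero_or_pos (l' + excess j I) with h0 | h0
  · rw [resonance, ← Nat.cast_add, h0] at hre
    exact hne (by simpa using hre)
  · have h1 : (1 : ℝ) ≤ l' + excess j I := by exact_mod_cast h0
    rw [resonance] at hre
    nlinarith

end Eigenform

/-! ### The ground state -/

/-- The form `exp (-T |Z'|² / 2 - s Z_n) e^1 ∧ … ∧ e^j`. -/
def gaussForm {T : ℝ} (hT : 0 < T) (m j : ℕ) {s : ℂ} (hs : 0 < s.re) : L2Forms m :=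
  formLp hT (polyTest T 1 hs) (basisVec (negSet m j))

theorem coeFn_gaussForm {T : ℝ} (hT : 0 < T) (m j : ℕ) {s : ℝ} (hs : 0 < (s : ℂ).re) :
    gaussForm hT m j hs =ᵐ[μ m] fun Z =>
      Real.exp (-(T / 2) * ∑ i : Fin m, Z i.castSucc ^ 2 - s * Z (Fin.last m)) •
        basisVec (negSet m j) := by
  filter_upwards [coeFn_formLp hT (polyTest T 1 hs) (basisVec (negSet m j))] with Z hZ
  rw [gaussForm, hZ]
  congr 1
  simp only [polyTest, polyExp, map_one, one_mul]
  rw [gaussExp_ofReal, Complex.ofReal_re]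

theorem last_notMem_negSet {m j : ℕ} (hj : j ≤ m) : Fin.last m ∉ negSet m j := by
  simpa [negSet] using hj

theorem excess_negSet (m j : ℕ) : excess j (negSet m j) = 0 := by
  simp [excess, negSet]

theorem eq_negSet {m j : ℕ} (hj : j ≤ m) {I : Finset (Fin (m + 1))} (hI : excess j I = 0)
    (hlast : Fin.last m ∉ I) : I = negSet m j := by
  rw [excess, Finset.card_eq_zero, Finset.filter_eq_empty_iff] at hI
  ext i
  refine Fin.lastCases ?_ (fun i => ?_) i
  · exact iff_of_false hlast (last_notMem_negSet hj)
  · have := hI (Finset.mem_univ i)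
    rw [not_not] at this
    simpa [negSet] using this

theorem gaussForm_mem_graph {T : ℝ} (hT : 0 < T) {m j : ℕ} (hj : j ≤ m) (c : ℝ)
    (hs : 0 < (T : ℂ).re) : (gaussForm hT m j hs, 0) ∈ (wittenLaplacian m j c T).graph := by
  have hbc : BdryCond j (negSet m j) (polyTest T 1 hs) := by
    rw [BdryCond, if_neg (last_notMem_negSet hj), lower_last_polyTest T j (by simp), sub_self,
      zero_smul]
    exact Submodule.zero_mem _
  have hham : ham j (negSet m j) (polyTest T 1 hs) = 0 := by
    have h := ham_polyTest (m := m) T j (negSet m j) 0 0 hs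
    rw [pow_zero] at h
    rw [h, excess_negSet]
    simp
  have h := formLp_mem_graph_wittenLaplacian hT (dense_domain_modelDT hT j c) hbc
  rwa [hham, map_zero, LinearMap.zero_apply] at h

/-- At a real parameter the transform of degree zero is an inner product. -/
theorem coeffTransform_zero_eq_inner {T : ℝ} (hT : 0 < T) {m : ℕ} (j : ℕ) (w : L2Forms m)
    (a : Fin m → ℝ) {s : ℝ} (hs : 0 < (s : ℂ).re) :
    coeffTransform T w (negSet m j) a 0 s = (⟪w, gaussForm hT m j hs⟫_ℝ : ℝ) := by
  have h1 : coeffTransform T w (negSet m j) a 0 s = ((∫ Z, w Z (negSet m j) *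
      Real.exp (-(T / 2) * ∑ i : Fin m, Z i.castSucc ^ 2 - s * Z (Fin.last m)) ∂(μ m) : ℝ) : ℂ) := by
    rw [coeffTransform, ← integral_complex_ofReal]
    refine integral_congr_ae (Filter.Eventually.of_forall fun Z => ?_)
    simp only [polyExp, pow_zero, map_one, one_mul]
    rw [gaussExp_ofReal, ← Complex.ofReal_mul]
  have h2 : coeffTransform T w (negSet m j) a 0 s =
      coeffPairing hT w (negSet m j) (polyTest T 1 hs) := by
    rw [← coeffPairing_polyTest hT w (negSet m j) a 0 hs]
    simp only [pow_zero]
  rw [gaussForm, inner_formLp_basisVec, ← h2, h1, Complex.ofReal_re]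

theorem inner_gaussForm_pos {T : ℝ} (hT : 0 < T) (m j : ℕ) {s t : ℝ} (hs : 0 < (s : ℂ).re)
    (ht : 0 < (t : ℂ).re) : 0 < ⟪gaussForm hT m j hs, gaussForm hT m j ht⟫_ℝ := by
  rw [L2.inner_def]
  have hI := L2.integrable_inner (𝕜 := ℝ) (gaussForm hT m j hs) (gaussForm hT m j ht)
  have hpos : ∀ᵐ Z ∂(μ m), 0 < ⟪gaussForm hT m j hs Z, gaussForm hT m j ht Z⟫_ℝ := by
    filter_upwards [coeFn_gaussForm hT m j hs, coeFn_gaussForm hT m j ht] with Z h1 h2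
    rw [h1, h2, real_inner_smul_left, real_inner_smul_right, real_inner_self_eq_norm_sq,
      PiLp.norm_single]
    norm_num
    positivity
  refine (integral_pos_iff_support_of_nonneg_ae (hpos.mono fun _ h => h.le) hI).2 ?_
  have hsupp : Function.support (fun Z => ⟪gaussForm hT m j hs Z, gaussForm hT m j ht Z⟫_ℝ)
      =ᵐ[μ m] Set.univ := by
    filter_upwards [hpos] with Z hZ
    exact propext ⟨fun _ => trivial, fun _ => hZ.ne'⟩
  rw [measure_congr hsupp, μ, Measure.restrict_apply_univ]
  refine (halfSpace m).isOpen.measure_pos volume ⟨EuclideanSpace.single (Fin.last m) 1, ?_⟩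
  change (0 : ℝ) < _
  simp

/-- A harmonic form orthogonal to `gaussForm` at the parameter `2 T` vanishes. Any parameter other
than that of the ground state, which is `T`, would do. -/
theorem eq_zero_of_harmonic_of_inner_eq_zero {T : ℝ} (hT : 0 < T) {m j : ℕ} (hj : j ≤ m) {c : ℝ}
    {w : L2Forms m} (hw : (w, 0) ∈ (wittenLaplacian m j c T).graph)
    (hs : 0 < ((2 * T : ℝ) : ℂ).re) (horth : ⟪w, gaussForm hT m j hs⟫_ℝ = 0) : w = 0 := by
  refine eq_zero_of_mem_graph_of_lt (lam := 0) hT (by rwa [zero_smul]) (by linarith) ?_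
  intro _ I hex hI a
  rw [eq_negSet hj hex hI]
  have h := coeffTransform_zero_eq_inner hT j w a hs
  rw [horth] at h
  simpa using h

theorem kernel_wittenLaplacian {T : ℝ} (hT : 0 < T) {m j : ℕ} (hj : j ≤ m) (c : ℝ)
    (hs : 0 < (T : ℂ).re) :
    kernel (wittenLaplacian m j c T) = Submodule.span ℝ {gaussForm hT m j hs} := by
  refine le_antisymm (fun w hw => ?_) ?_
  · have h2 : 0 < ((2 * T : ℝ) : ℂ).re := by
      rw [Complex.ofReal_re]
      linarith
    have hp := inner_gaussForm_pos hT m j hs h2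
    set β := gaussForm hT m j hs
    set r : ℝ := ⟪w, gaussForm hT m j h2⟫_ℝ / ⟪β, gaussForm hT m j h2⟫_ℝ with hr
    have hmem : (w - r • β, 0) ∈ (wittenLaplacian m j c T).graph := by
      have := Submodule.sub_mem _ (mem_kernel_iff.1 hw)
        (Submodule.smul_mem _ r (gaussForm_mem_graph hT hj c hs))
      simpa using this
    have h0 := eq_zero_of_harmonic_of_inner_eq_zero hT hj hmem h2 (by
      rw [inner_sub_left, real_inner_smul_left, hr, div_mul_cancel₀ _ hp.ne', sub_self])
    rw [Submodule.mem_span_singleton]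
    exact ⟨r, (sub_eq_zero.1 h0).symm⟩
  · rw [Submodule.span_singleton_le_iff_mem, mem_kernel_iff]
    exact gaussForm_mem_graph hT hj c hs

end

end HalfSpaceWitten

theorem proposition3 (m j : ℕ) (hj : j ≤ m) (c T : ℝ) (hT : 0 < T) :
    (∃ β : HalfSpaceWitten.L2Forms m,
      β =ᵐ[HalfSpaceWitten.μ m] HalfSpaceWitten.groundState m j hj T ∧
      HalfSpaceWitten.kernel (HalfSpaceWitten.wittenLaplacian m j c T) =
        Submodule.span ℝ {β}) ∧
    Module.finrank ℝ (HalfSpaceWitten.kernel (HalfSpaceWitten.wittenLaplacian m j c T)) = 1 ∧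
    ∀ lam : ℝ, HalfSpaceWitten.IsEigenvalue (HalfSpaceWitten.wittenLaplacian m j c T) lam →
      lam ≠ 0 → 2 * T ≤ lam := by
  have hs : 0 < (T : ℂ).re := hT
  have hker := HalfSpaceWitten.kernel_wittenLaplacian hT hj c hs
  refine ⟨⟨HalfSpaceWitten.gaussForm hT m j hs, ?_, hker⟩, ?_, ?_⟩
  · refine (HalfSpaceWitten.coeFn_gaussForm hT m j hs).trans
      (Filter.Eventually.of_forall fun Z => ?_)
    rw [HalfSpaceWitten.groundState, HalfSpaceWitten.coords_ιMulti hj]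
  · rw [hker]
    refine finrank_span_singleton fun h0 => ?_
    have hp := HalfSpaceWitten.inner_gaussForm_pos hT m j hs hs
    rw [h0, inner_zero_left] at hp
    exact hp.false
  · rintro lam ⟨w, hw0, hw⟩ hlam
    by_contra! hlt
    refine hw0 (Subtype.ext ?_)
    refine HalfSpaceWitten.eq_zero_of_mem_graph_of_lt (j := j) (c := c) (lam := lam) hT ?_ hlt
      fun h => absurd h hlam
    exact (LinearPMap.mem_graph_iff _).2 ⟨w, rfl, hw⟩
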